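/- A BL-algebra is an algebra $(L,\otimes,\to,0,1)$ such that $(L,\otimes,1)$ is a commutative monoid and, for all $x,y,z\in L$: $x\to x=1$, $x\otimes(x\to y)=y\otimes(y\to x)$, $x\to(y\to z)=(x\otimes y)\to z$, and, with respect to the partial order $x\le y\iff x\to y=1$, the element $0$ is the least element and $(x\to y)\to z\le((y\to x)\to z)\to z$. In such an algebra put $x\wedge y=x\otimes(x\to y)$, $\bar x=x\to 0$ and $x+y=(\bar x\to y)\wedge(\bar y\to x)$; the operation $+$ on $L$ is commutative and associative. A good sequence in $L$ is a sequence $\mathbf a=(a_1,a_2,\dots)$ in $L$ with $a_i+a_{i+1}=a_i$ for all $i$ and $a_r=0$ for all large $r$. The set $M_L$ of good sequences is ordered componentwise, has the element $(0)=(0,0,\dots)$, and is closed under the commutative operation $\mathbf a+\mathbf b=\mathbf c$, $c_i=a_i+(a_{i-1}\otimes b_1)+\cdots+(a_1\otimes b_{i-1})+b_i$. A sum of three good sequences is bracketed as $\mathbf a+\mathbf b+\mathbf c=(\mathbf a+\mathbf b)+\mathbf c$. For $\mathbf a\in M_L$ write $\overline{\overline{\mathbf a}}=(\overline{\overline{a_1}},\overline{\overline{a_2}},\dots)\in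 M_L$. Let $G_L$ be the set of classes $[\mathbf a,\mathbf b]$ of pairs in $M_L\times M_L$ under the equivalence relation: $(\mathbf a,\mathbf b)\sim(\mathbf c,\mathbf d)$ if and only if $\mathbf a+\mathbf d+\mathbf k=\mathbf b+\mathbf c+\mathbf k$ for some $\mathbf k\in M_L$. It is an abelian group under $[\mathbf a,\mathbf b]+[\mathbf c,\mathbf d]=[\mathbf a+\mathbf c,\mathbf b+\mathbf d]$, with zero $[(0),(0)]$ and $-[\mathbf a,\mathbf b]=[\mathbf b,\mathbf a]$, and it is partially ordered, with translation-invariant order, by: $[\mathbf a,\mathbf b]\preceq[\mathbf c,\mathbf d]$ if and only if $\mathbf a+\mathbf d+\mathbf k\le\mathbf b+\mathbf c+\mathbf k$ for some $\mathbf k\in M_L$. Let $\mathfrak S(L)=\{[\mathbf a,\mathbf b]:\mathbf a,\mathbf b\in M_L,\ \overline{\overline{\mathbf a}}=\overline{\overline{\mathbf b}}\}$, a subgroup of $G_L$ with the induced order. Let $A=\{\bar x:x\in L\}$ be the MV-center of $L$; it is a subalgebra of $L$, hence a BL-algebra, with its own group $G_A$, and $\overline{\overline{\mathbf a}}\in M_A$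 for all $\mathbf a\in M_L$. **Corollary.** Let $L$ be a BL-algebra with MV-center $A$. Let $G_A\times_{lex}\mathfrak S(L)$ be the product group with the lexicographic order: $(g,s)\le(g',s')$ if and only if $g\prec g'$, or $g=g'$ and $s\preceq s'$. Then $$\Theta([\mathbf a,\mathbf b])=\bigl([\overline{\overline{\mathbf a}},\overline{\overline{\mathbf b}}],\ [\mathbf a+\overline{\overline{\mathbf b}},\ \mathbf b+\overline{\overline{\mathbf a}}]\bigr)$$ defines an isomorphism of groups $\Theta$ from $G_L$ onto $G_A\times_{lex}\mathfrak S(L)$ that is order preserving: $x\preceq y$ in $G_L$ implies $\Theta(x)\le\Theta(y)$. -/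

import Mathlib

/-- A BL-algebra, presented as a bounded hoop `(L, *, ⇨, 0, 1)`: `x * y` is the monoid operation
`x ⊗ y`, `x ⇨ y` is the implication `x → y`, and the lattice order is derived from `⇨` below. -/
class BLAlgebra (L : Type*) extends CommMonoid L, Zero L, HImp L where
  himp_self : ∀ x : L, x ⇨ x = 1
  mul_himp_comm : ∀ x y : L, x * (x ⇨ y) = y * (y ⇨ x)
  himp_himp : ∀ x y z : L, x ⇨ (y ⇨ z) = (x * y) ⇨ z
  /-- `0` is the least element: `0 ≤ x`, that is `0 ⇨ x = 1`. -/
  zero_himp : ∀ x : L, 0 ⇨ x = 1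
  /-- `(x → y) → z ≤ ((y → x) → z) → z`, where `u ≤ v` stands for `u → v = 1`. -/
  prelinear : ∀ x y z : L, ((x ⇨ y) ⇨ z) ⇨ (((y ⇨ x) ⇨ z) ⇨ z) = 1

namespace BLAlgebra

universe u

section Basic

variable {L : Type u} [BLAlgebra L]

theorem himp_left_comm' (x y z : L) : x ⇨ (y ⇨ z) = y ⇨ (x ⇨ z) := by
  rw [himp_himp, himp_himp, mul_comm]

theorem himp_one' (x : L) : x ⇨ (1 : L) = 1 := by
  have h0 : x ⇨ ((1 : L) ⇨ x) = 1 := by rw [himp_himp, mul_one, himp_self]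
  have h2 : (1 : L) ⇨ x = x * (x ⇨ 1) := by
    have := mul_himp_comm (1 : L) x
    rwa [one_mul] at this
  have e1 : x = ((1 : L) ⇨ x) * (((1 : L) ⇨ x) ⇨ x) := by
    rw [← mul_himp_comm, h0, mul_one]
  have e2 : ((1 : L) ⇨ x) ⇨ x = (x ⇨ 1) ⇨ 1 := by
    rw [h2, mul_comm, ← himp_himp, himp_self]
  have e3 : (x ⇨ (1 : L)) * ((x ⇨ (1 : L)) ⇨ 1) = x ⇨ 1 := by
    rw [mul_himp_comm, one_mul, himp_himp, one_mul]
  rw [h2] at e1 e2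
  rw [e2, mul_assoc, e3] at e1
  generalize hd : x ⇨ (1 : L) = d at *
  -- now `x = x * d`
  have h1 : d ⇨ (1 : L) = 1 := by
    have h4 : d ⇨ (x ⇨ x) = (d * x) ⇨ x := himp_himp _ _ _
    rwa [mul_comm, ← e1, himp_self] at h4
  have h5 : x ⇨ d = d := by
    have h4 : x ⇨ (d ⇨ d) = (x * d) ⇨ d := himp_himp _ _ _
    rw [← e1, himp_self, hd] at h4
    exact h4.symm
  have h6 : d * (d ⇨ x) = x := by rw [mul_himp_comm, h5, ← e1]
  have h7 : (d ⇨ x) ⇨ (1 : L) = d := by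
    have h8 : (d ⇨ x) ⇨ (d ⇨ (1 : L)) = ((d ⇨ x) * d) ⇨ 1 := himp_himp _ _ _
    rwa [h1, mul_comm, h6, hd] at h8
  have h9 : d ⇨ ((d ⇨ x) ⇨ (1 : L)) = (d * (d ⇨ x)) ⇨ 1 := himp_himp _ _ _
  rw [h7, h6, hd, himp_self] at h9
  exact h9.symm

theorem one_himp' (x : L) : (1 : L) ⇨ x = x := by
  have := mul_himp_comm (1 : L) x
  rwa [one_mul, himp_one', mul_one] at this

/-- The order of a BL-algebra: `x ≤ y` if and only if `x → y = 1`. -/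
instance instPartialOrder : PartialOrder L where
  le x y := x ⇨ y = 1
  le_refl := himp_self
  le_trans x y z hxy hyz := by
    change x ⇨ y = 1 at hxy
    change y ⇨ z = 1 at hyz
    have h : x = y * (y ⇨ x) := by rw [← mul_himp_comm, hxy, mul_one]
    change x ⇨ z = 1
    rw [h, mul_comm, ← himp_himp, hyz, himp_one']
  le_antisymm x y hxy hyx := by
    change x ⇨ y = 1 at hxy
    change y ⇨ x = 1 at hyx
    have h := mul_himp_comm x y
    rwa [hxy, hyx, mul_one, mul_one] at h

theorem le_iff_himp {x y : L} : x ≤ y ↔ x ⇨ y = 1 := Iff.rfl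

theorem mul_le_iff {x y z : L} : x * y ≤ z ↔ x ≤ y ⇨ z := by
  rw [le_iff_himp, le_iff_himp, himp_himp]

theorem le_one' (x : L) : x ≤ 1 := himp_one' x

theorem zero_le' (x : L) : 0 ≤ x := zero_himp x

theorem eq_zero_of_le {x : L} (h : x ≤ 0) : x = 0 := le_antisymm h (zero_le' x)

theorem eq_one_of_ge {x : L} (h : 1 ≤ x) : x = 1 := le_antisymm (le_one' x) h

theorem mul_mono_right {x y : L} (z : L) (h : x ≤ y) : x * z ≤ y * z :=
  mul_le_iff.2 (h.trans (mul_le_iff.1 le_rfl))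

theorem mul_mono_left {x y : L} (z : L) (h : x ≤ y) : z * x ≤ z * y := by
  rw [mul_comm z x, mul_comm z y]; exact mul_mono_right z h

theorem mul_mono {x y z t : L} (h : x ≤ y) (h' : z ≤ t) : x * z ≤ y * t :=
  (mul_mono_right z h).trans (mul_mono_left y h')

theorem mul_le_left' (x y : L) : x * y ≤ x := by
  simpa using mul_mono_left x (le_one' y)

theorem mul_le_right' (x y : L) : x * y ≤ y := by
  rw [mul_comm]; exact mul_le_left' y x

theorem mul_zero' (x : L) : x * 0 = 0 := eq_zero_of_le (mul_le_right' x 0)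

theorem zero_mul' (x : L) : 0 * x = 0 := eq_zero_of_le (mul_le_left' 0 x)

theorem himp_mul_le (x y : L) : (x ⇨ y) * x ≤ y := mul_le_iff.2 le_rfl

theorem himp_mono_right {x y : L} (z : L) (h : x ≤ y) : z ⇨ x ≤ z ⇨ y :=
  mul_le_iff.1 ((himp_mul_le z x).trans h)

theorem himp_mono_left {x y : L} (z : L) (h : x ≤ y) : y ⇨ z ≤ x ⇨ z :=
  mul_le_iff.1 ((mul_mono_left _ h).trans (himp_mul_le y z))

theorem le_himp_right (x y : L) : y ≤ x ⇨ y := mul_le_iff.1 (mul_le_left' y x)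

/-- `x ∧ y = x ⊗ (x → y)`. -/
instance instMin : Min L := ⟨fun x y => x * (x ⇨ y)⟩

theorem inf_def (x y : L) : x ⊓ y = x * (x ⇨ y) := rfl

/-- The meet operation is the infimum for the order. -/
instance instSemilatticeInf : SemilatticeInf L where
  inf x y := x ⊓ y
  inf_le_left x y := mul_le_left' _ _
  inf_le_right x y := by
    change x * (x ⇨ y) ≤ y
    rw [mul_comm]; exact himp_mul_le x y
  le_inf x y z hxy hxz := by
    have h : x = y * (y ⇨ x) := by rw [← mul_himp_comm, le_iff_himp.1 hxy, mul_one]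
    have h' : y ⇨ x ≤ y ⇨ z := himp_mono_right y hxz
    calc x = y * (y ⇨ x) := h
      _ ≤ y * (y ⇨ z) := mul_mono_left y h'

/-- The complementation `x̄ = x → 0`. -/
instance instCompl : Compl L := ⟨fun x => x ⇨ 0⟩

theorem compl_def (x : L) : xᶜ = x ⇨ 0 := rfl

/-- The addition `x + y = (x̄ → y) ∧ (ȳ → x)`. -/
instance instAdd : Add L := ⟨fun x y => (xᶜ ⇨ y) ⊓ (yᶜ ⇨ x)⟩

theorem add_def (x y : L) : x + y = (xᶜ ⇨ y) ⊓ (yᶜ ⇨ x) := rfl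

theorem compl_anti {x y : L} (h : x ≤ y) : yᶜ ≤ xᶜ := himp_mono_left 0 h

theorem le_cc (x : L) : x ≤ xᶜᶜ := by
  have : x * xᶜ ≤ 0 := by rw [mul_comm]; exact himp_mul_le x 0
  exact mul_le_iff.1 this

theorem ccc (x : L) : xᶜᶜᶜ = xᶜ := le_antisymm (compl_anti (le_cc x)) (le_cc _)

theorem compl_zero' : (0 : L)ᶜ = 1 := himp_self 0

theorem compl_one' : (1 : L)ᶜ = 0 := one_himp' 0

theorem himp_compl (x y : L) : x ⇨ yᶜ = (x * y)ᶜ := himp_himp x y 0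

theorem mul_compl' (x : L) : x * xᶜ = 0 := by
  rw [mul_comm]; exact eq_zero_of_le (himp_mul_le x 0)

theorem mul_eq_zero_iff' {x y : L} : x * y = 0 ↔ x ≤ yᶜ :=
  ⟨fun h => mul_le_iff.1 h.le, fun h => eq_zero_of_le (mul_le_iff.2 h)⟩

theorem compl_cc_mul (x y : L) : (xᶜᶜ * y)ᶜ = (x * y)ᶜ := by
  rw [mul_comm, ← himp_compl, ccc, himp_compl, mul_comm]

/-- `x → y̿ = x̿ → y̿`. -/
theorem cc_himp_cc (x y : L) : xᶜᶜ ⇨ yᶜᶜ = x ⇨ yᶜᶜ := by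
  rw [himp_compl, himp_compl, compl_cc_mul]

theorem add_comm' (x y : L) : x + y = y + x := by
  rw [add_def, add_def]; exact inf_comm _ _

theorem zero_add' (x : L) : 0 + x = x := by
  rw [add_def, compl_zero', one_himp']
  exact inf_eq_left.2 (le_cc x)

theorem add_mono' {x y z t : L} (h : x ≤ y) (h' : z ≤ t) : x + z ≤ y + t := by
  rw [add_def, add_def]
  exact inf_le_inf ((himp_mono_left _ (compl_anti h)).trans (himp_mono_right _ h'))
    ((himp_mono_left _ (compl_anti h')).trans (himp_mono_right _ h))

theorem le_add_left' (x y : L) : x ≤ x + y := by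
  have := add_mono' (le_refl x) (zero_le' y)
  rwa [add_comm', zero_add'] at this

theorem one_add' (x : L) : 1 + x = 1 := eq_one_of_ge (le_add_left' 1 x)

theorem eq_zero_of_compl {x : L} (h : xᶜ = 1) : x = 0 := eq_zero_of_le h

end Basic

/-! ### BL-chains -/

section Chain

variable {L : Type u} [BLAlgebra L]

/-- In a BL-chain, a regular element below `1` is absorbed by a dense element. -/
theorem chain_absorb (hc : ∀ x y : L, x ≤ y ∨ y ≤ x) {y e : L} (hy : yᶜᶜ = y) (hy1 : y ≠ 1)
    (he : eᶜ = 0) : y ≤ e ∧ y * e = y := by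
  have hle : y ≤ e := by
    rcases hc y e with h | h
    · exact h
    · exfalso
      have h1 : yᶜ = 0 := eq_zero_of_le ((compl_anti h).trans he.le)
      rw [h1, compl_zero'] at hy
      exact hy1 hy.symm
  refine ⟨hle, ?_⟩
  have h1 : e ⇨ y = y := by
    conv_lhs => rw [← hy]
    rw [himp_compl, mul_comm, ← himp_compl, he]
    exact hy
  have h2 := mul_himp_comm y e
  rw [le_iff_himp.1 hle, mul_one, h1, mul_comm] at h2
  exact h2.symm

theorem chain_dichotomy (hc : ∀ x y : L, x ≤ y ∨ y ≤ x) (x : L) : xᶜᶜ = x ∨ xᶜ = 0 := by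
  by_cases h1 : xᶜᶜ = 1
  · right
    rw [← ccc, h1, compl_one']
  · left
    have he : (xᶜᶜ ⇨ x)ᶜ = 0 := by
      have h2 : xᶜ ≤ xᶜᶜ ⇨ x := by
        refine mul_le_iff.1 ?_
        rw [mul_compl']; exact zero_le' x
      have h5 : (xᶜᶜ ⇨ x)ᶜ ≤ xᶜᶜ := compl_anti h2
      have h3 : xᶜᶜ * (xᶜᶜ ⇨ x) = x := by
        rw [mul_himp_comm, le_iff_himp.1 (le_cc x), mul_one]
      have h4 := mul_himp_comm (xᶜᶜ ⇨ x)ᶜ xᶜᶜ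
      rw [le_iff_himp.1 h5, mul_one, himp_compl, h3, mul_comm, mul_compl'] at h4
      exact h4
    have h2 := (chain_absorb hc (ccc xᶜ) h1 he).2
    have h3 := mul_himp_comm xᶜᶜ x
    rw [h2, le_iff_himp.1 (le_cc x), mul_one] at h3
    exact h3

/-- In a BL-chain, the sum of a dense element and a nonzero element is `1`. -/
theorem chain_add_dense (hc : ∀ x y : L, x ≤ y ∨ y ≤ x) {x y : L} (hx : xᶜ = 0) (hy : y ≠ 0) :
    x + y = 1 := by
  have h1 : xᶜ ⇨ y = 1 := by rw [hx]; exact zero_himp y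
  have h2 : yᶜ ⇨ x = 1 := by
    by_cases h : yᶜ = 1
    · exact absurd (eq_zero_of_compl h) hy
    · exact le_iff_himp.1 (chain_absorb hc (ccc y) h hx).1
  rw [add_def, h1, h2, inf_idem]

theorem add_regular {x y : L} (hx : xᶜᶜ = x) (hy : yᶜᶜ = y) : x + y = (xᶜ * yᶜ)ᶜ := by
  have h1 : xᶜ ⇨ y = (xᶜ * yᶜ)ᶜ := by rw [← himp_compl, hy]
  have h2 : yᶜ ⇨ x = (xᶜ * yᶜ)ᶜ := by rw [mul_comm, ← himp_compl, hx]
  rw [add_def, h1, h2, inf_idem]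

theorem chain_add_assoc (hc : ∀ x y : L, x ≤ y ∨ y ≤ x) (x y z : L) :
    x + y + z = x + (y + z) := by
  by_cases hx0 : x = 0
  · rw [hx0, zero_add', zero_add']
  by_cases hy0 : y = 0
  · rw [hy0, zero_add', add_comm' x 0, zero_add']
  by_cases hz0 : z = 0
  · rw [hz0, add_comm' _ 0, add_comm' y 0, zero_add', zero_add']
  have key : ∀ a b : L, a ≠ 0 → a + b ≠ 0 := fun a b ha h =>
    ha (eq_zero_of_le ((le_add_left' a b).trans h.le))
  rcases chain_dichotomy hc x with hx | hx
  · rcases chain_dichotomy hc y with hy | hy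
    · rcases chain_dichotomy hc z with hz | hz
      · rw [add_regular hx hy, add_regular hy hz, add_regular (ccc _) hz, add_regular hx (ccc _),
          compl_cc_mul, mul_comm xᶜ (yᶜ * zᶜ)ᶜᶜ, compl_cc_mul, mul_assoc, mul_comm xᶜ]
      · rw [add_comm' _ z, chain_add_dense hc hz (key _ _ hx0), add_comm' y z,
          chain_add_dense hc hz hy0, add_comm' x 1, one_add']
    · rw [add_comm' x y, chain_add_dense hc hy hx0, one_add', chain_add_dense hc hy hz0,
        add_comm' x 1, one_add']
  · rw [chain_add_dense hc hx hy0, one_add', chain_add_dense hc hx (key _ _ hy0)]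

theorem chain_mul_eq_zero (hc : ∀ x y : L, x ≤ y ∨ y ≤ x) (x y : L) : x + y = 1 ∨ x * y = 0 := by
  rcases hc x yᶜ with h | h
  · exact Or.inr (mul_eq_zero_iff'.2 h)
  rcases hc y xᶜ with h' | h'
  · right; rw [mul_comm]; exact mul_eq_zero_iff'.2 h'
  · left
    rw [add_def, le_iff_himp.1 h, le_iff_himp.1 h', inf_idem]

theorem chain_add_mul (hc : ∀ x y : L, x ≤ y ∨ y ≤ x) (x y : L) : x + y + x * y = x + y := by
  rcases chain_mul_eq_zero hc x y with h | h
  · rw [h, one_add']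
  · rw [h, add_comm', zero_add']

/-- Regular elements of a BL-chain are closed under the product. -/
theorem chain_mul_regular (hc : ∀ x y : L, x ≤ y ∨ y ≤ x) {x y : L} (hx : xᶜᶜ = x)
    (hy : yᶜᶜ = y) : (x * y)ᶜᶜ = x * y := by
  rcases chain_dichotomy hc (x * y) with h | h
  · exact h
  · have hx1 : x = 1 := by
      rw [← hx, eq_zero_of_le ((compl_anti (mul_le_left' x y)).trans h.le), compl_zero']
    rw [hx1, one_mul, hy]

theorem chain_cc_mul (hc : ∀ x y : L, x ≤ y ∨ y ≤ x) (x y : L) :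
    (x * y)ᶜᶜ = xᶜᶜ * yᶜᶜ := by
  rw [← compl_cc_mul, mul_comm, ← compl_cc_mul, mul_comm]
  exact chain_mul_regular hc (ccc _) (ccc _)

theorem chain_cc_himp (hc : ∀ x y : L, x ≤ y ∨ y ≤ x) (x y : L) :
    (x ⇨ y)ᶜᶜ = xᶜᶜ ⇨ yᶜᶜ := by
  rw [cc_himp_cc]
  rcases chain_dichotomy hc y with h | h
  · rw [h]
    conv_lhs => rw [← h]
    conv_rhs => rw [← h]
    rw [himp_compl, ccc]
  · have h1 : (x ⇨ y)ᶜ = 0 := eq_zero_of_le ((compl_anti (le_himp_right x y)).trans h.le)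
    rw [h1, h, compl_zero', himp_one']

theorem chain_himp_mul (hc : ∀ x y : L, x ≤ y ∨ y ≤ x) {a b : L} (ha : aᶜᶜ = a) (hb : bᶜᶜ = b)
    (h : aᶜ ≤ b) : a ⇨ (a * b) = b := by
  have h1 : bᶜ ≤ a := (compl_anti h).trans ha.le
  have h2 := mul_himp_comm a bᶜ
  rw [le_iff_himp.1 h1, mul_one, himp_compl] at h2
  rw [← chain_mul_regular hc ha hb, himp_compl, h2, hb]

/-- Regular elements with `x + y = 1`. -/
theorem compl_le_of_add_eq_one {x y : L} (h : x + y = 1) : xᶜ ≤ y := by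
  rw [add_def] at h
  exact le_iff_himp.2 (eq_one_of_ge (h.ge.trans inf_le_left))

theorem idass_aux1 (hc : ∀ x y : L, x ≤ y ∨ y ≤ x) {x y z : L} (hx : xᶜᶜ = x) (hy : yᶜᶜ = y)
    (hz : zᶜᶜ = z) (h1 : x + y = 1) (h2 : x * z = 0) : x * y + z = (x + z) * y := by
  have hxz : x ≤ zᶜ := mul_eq_zero_iff'.1 h2
  have hyx : yᶜ ≤ x := (compl_anti (compl_le_of_add_eq_one h1)).trans hx.le
  have hr : ((x + z) * y)ᶜᶜ = (x + z) * y :=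
    chain_mul_regular hc (by rw [add_regular hx hz, ccc]) hy
  rw [add_regular (chain_mul_regular hc hx hy) hz, ← hr]
  congr 1
  rw [← himp_compl x y, ← himp_compl (x + z) y]
  have e1 : x + z = zᶜ ⇨ x := by
    conv_rhs => rw [← hx]
    rw [himp_compl, add_regular hx hz, mul_comm]
  rw [e1, mul_comm]
  -- with `Y = yᶜ ≤ x ≤ Z = zᶜ`: `Z * (x → Y) = (Z → x) → Y`
  have hY : yᶜ = (zᶜ ⇨ x) * (zᶜ * (x ⇨ yᶜ)) := by
    have e2 : x = zᶜ * (zᶜ ⇨ x) := by rw [← mul_himp_comm, le_iff_himp.1 hxz, mul_one]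
    have e3 : yᶜ = x * (x ⇨ yᶜ) := by rw [mul_himp_comm, le_iff_himp.1 hyx, mul_one]
    calc yᶜ = x * (x ⇨ yᶜ) := e3
      _ = zᶜ * (zᶜ ⇨ x) * (x ⇨ yᶜ) := by rw [← e2]
      _ = _ := by rw [mul_comm zᶜ, mul_assoc]
  conv_rhs => rw [hY]
  symm
  apply chain_himp_mul hc
  · rw [← e1, add_regular hx hz, ccc]
  · refine chain_mul_regular hc (ccc z) ?_
    rw [himp_compl, ccc]
  · rw [← e1, add_regular hx hz, chain_mul_regular hc (ccc x) (ccc z), mul_comm]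
    refine mul_mono_left _ (mul_le_iff.1 ?_)
    rw [mul_comm, mul_compl']
    exact zero_le' _

theorem chain_idass (hc : ∀ x y : L, x ≤ y ∨ y ≤ x) {x y z : L} (hx : xᶜᶜ = x) (hy : yᶜᶜ = y)
    (hz : zᶜᶜ = z) : x * y + (x + y) * z = x * z + (x + z) * y := by
  rcases chain_mul_eq_zero hc x y with h1 | h1 <;> rcases chain_mul_eq_zero hc x z with h2 | h2
  · rw [h1, h2, one_mul, one_mul, add_regular (chain_mul_regular hc hx hy) hz,
      add_regular (chain_mul_regular hc hx hz) hy, ← himp_compl x y, ← himp_compl x z]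
    have hyx : yᶜ ≤ x := (compl_anti (compl_le_of_add_eq_one h1)).trans hx.le
    have hzx : zᶜ ≤ x := (compl_anti (compl_le_of_add_eq_one h2)).trans hx.le
    have e1 : zᶜ = x * (x ⇨ zᶜ) := by rw [mul_himp_comm, le_iff_himp.1 hzx, mul_one]
    have e2 : yᶜ = x * (x ⇨ yᶜ) := by rw [mul_himp_comm, le_iff_himp.1 hyx, mul_one]
    have : (x ⇨ yᶜ) * zᶜ = (x ⇨ zᶜ) * yᶜ := by
      calc (x ⇨ yᶜ) * zᶜ = (x ⇨ yᶜ) * (x * (x ⇨ zᶜ)) := by rw [← e1]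
        _ = (x ⇨ zᶜ) * (x * (x ⇨ yᶜ)) := by
          rw [← mul_assoc, mul_comm _ x, mul_comm (x ⇨ zᶜ)]
        _ = _ := by rw [← e2]
    rw [this]
  · rw [h1, h2, one_mul, zero_add']
    exact idass_aux1 hc hx hy hz h1 h2
  · rw [h1, h2, one_mul, zero_add']
    exact (idass_aux1 hc hx hz hy h2 h1).symm
  · rw [h1, h2, zero_add', zero_add']
    have hyx : y ≤ xᶜ := by rw [mul_comm] at h1; exact mul_eq_zero_iff'.1 h1
    have hzx : z ≤ xᶜ := by rw [mul_comm] at h2; exact mul_eq_zero_iff'.1 h2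
    have e1 : x + y = xᶜ ⇨ y := by
      conv_rhs => rw [← hy]
      rw [himp_compl, add_regular hx hy]
    have e2 : x + z = xᶜ ⇨ z := by
      conv_rhs => rw [← hz]
      rw [himp_compl, add_regular hx hz]
    have e3 : y = xᶜ * (xᶜ ⇨ y) := by rw [mul_himp_comm, le_iff_himp.1 hyx, mul_one]
    have e4 : z = xᶜ * (xᶜ ⇨ z) := by rw [mul_himp_comm, le_iff_himp.1 hzx, mul_one]
    rw [e1, e2]
    calc (xᶜ ⇨ y) * z = (xᶜ ⇨ y) * (xᶜ * (xᶜ ⇨ z)) := by rw [← e4]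
      _ = (xᶜ ⇨ z) * (xᶜ * (xᶜ ⇨ y)) := by
        rw [← mul_assoc, mul_comm _ xᶜ, mul_comm (xᶜ ⇨ z)]
      _ = _ := by rw [← e3]

/-- Cancellation for regular elements of a BL-chain. -/
theorem chain_reg_cancel (hc : ∀ x y : L, x ≤ y ∨ y ≤ x) {a b c : L} (ha : aᶜᶜ = a)
    (hb : bᶜᶜ = b) (hcc : cᶜᶜ = c) (h1 : a + c ≤ b + c) (h2 : a * c ≤ b * c) : a ≤ b := by
  rcases hc a b with h | h
  · exact h
  have e1 : b + c = a + c := le_antisymm (add_mono' h le_rfl) h1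
  have e2 : b * c = a * c := le_antisymm (mul_mono_right c h) h2
  rcases hc a cᶜ with h3 | h3
  · have e3 : cᶜ * bᶜ = cᶜ * aᶜ := by
      rw [add_regular hb hcc, add_regular ha hcc] at e1
      rw [← chain_mul_regular hc (ccc c) (ccc b), ← chain_mul_regular hc (ccc c) (ccc a),
        mul_comm cᶜ, e1, mul_comm cᶜ]
    have e4 := chain_himp_mul hc (ccc c) (ccc a) (by rw [hcc]; exact (le_cc c).trans (compl_anti h3))
    have e5 := chain_himp_mul hc (ccc c) (ccc b)
      (by rw [hcc]; exact (le_cc c).trans (compl_anti (h.trans h3)))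
    rw [e3, e4] at e5
    rw [← ha, e5, hb]
  · rcases hc b cᶜ with h4 | h4
    · have e3 : b * c = 0 := mul_eq_zero_iff'.2 h4
      have h5 : a ≤ cᶜ := mul_eq_zero_iff'.1 (e2 ▸ e3)
      have e6 : a = cᶜ := le_antisymm h5 h3
      have e7 : a + c = 1 := by
        rw [add_regular ha hcc, e6, hcc, mul_compl', compl_zero']
      have h6 : cᶜ ≤ b := by
        rw [add_comm'] at e1
        rw [e7] at e1
        exact compl_le_of_add_eq_one e1
      exact h5.trans h6
    · have e4 := chain_himp_mul hc hcc ha h3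
      have e5 := chain_himp_mul hc hcc hb h4
      rw [mul_comm, ← e2, mul_comm, e5] at e4
      exact e4.symm.le

end Chain

/-! ### Representation by chains -/

/-- Homomorphisms of BL-algebras. -/
structure Hom (L C : Type u) [BLAlgebra L] [BLAlgebra C] where
  toFun : L → C
  map_mul' : ∀ x y, toFun (x * y) = toFun x * toFun y
  map_himp' : ∀ x y, toFun (x ⇨ y) = toFun x ⇨ toFun y
  map_zero' : toFun 0 = 0

namespace Hom

variable {L C : Type u} [BLAlgebra L] [BLAlgebra C] (f : Hom L C)

theorem map_one' : f.toFun 1 = 1 := by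
  rw [← himp_self (0 : L), f.map_himp', himp_self]

theorem map_compl' (x : L) : f.toFun xᶜ = (f.toFun x)ᶜ := by
  rw [compl_def, f.map_himp', f.map_zero', compl_def]

theorem map_inf' (x y : L) : f.toFun (x ⊓ y) = f.toFun x ⊓ f.toFun y := by
  rw [inf_def, f.map_mul', f.map_himp', inf_def]

theorem map_add' (x y : L) : f.toFun (x + y) = f.toFun x + f.toFun y := by
  rw [add_def, f.map_inf', f.map_himp', f.map_himp', f.map_compl', f.map_compl', add_def]

end Hom

section Filters

variable {L : Type u} [BLAlgebra L]

/-- Filters (deductive systems) of a BL-algebra. -/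
structure IsFilter (F : Set L) : Prop where
  one_mem : (1 : L) ∈ F
  mp : ∀ x y : L, x ∈ F → x ⇨ y ∈ F → y ∈ F

namespace IsFilter

variable {F : Set L}

theorem mem_of_le (hF : IsFilter F) {x y : L} (hx : x ∈ F) (h : x ≤ y) : y ∈ F :=
  hF.mp x y hx (by rw [le_iff_himp.1 h]; exact hF.one_mem)

theorem mul_mem (hF : IsFilter F) {x y : L} (hx : x ∈ F) (hy : y ∈ F) : x * y ∈ F := by
  have h : x ≤ y ⇨ (x * y) := mul_le_iff.1 le_rfl
  exact hF.mp y _ hy (hF.mem_of_le hx h)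

theorem trans_mem (hF : IsFilter F) {x y z : L} (hx : x ⇨ y ∈ F) (hy : y ⇨ z ∈ F) :
    x ⇨ z ∈ F := by
  refine hF.mem_of_le (hF.mul_mem hx hy) (mul_le_iff.1 ?_)
  rw [mul_comm (x ⇨ y), mul_assoc]
  exact (mul_mono_left _ (himp_mul_le x y)).trans (himp_mul_le y z)

/-- The congruence of a filter. -/
def setoid (hF : IsFilter F) : Setoid L where
  r x y := x ⇨ y ∈ F ∧ y ⇨ x ∈ F
  iseqv :=
    { refl := fun x => by rw [himp_self]; exact ⟨hF.one_mem, hF.one_mem⟩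
      symm := fun h => ⟨h.2, h.1⟩
      trans := fun h h' => ⟨hF.trans_mem h.1 h'.1, hF.trans_mem h'.2 h.2⟩ }

theorem mul_congr_mem (hF : IsFilter F) {x x' y y' : L} (hx : x ⇨ x' ∈ F) (hy : y ⇨ y' ∈ F) :
    (x * y) ⇨ (x' * y') ∈ F := by
  refine hF.mem_of_le (hF.mul_mem hx hy) (mul_le_iff.1 ?_)
  calc (x ⇨ x') * (y ⇨ y') * (x * y) = ((x ⇨ x') * x) * ((y ⇨ y') * y) := mul_mul_mul_comm _ _ _ _
    _ ≤ _ := mul_mono (himp_mul_le _ _) (himp_mul_le _ _)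

theorem himp_congr_mem (hF : IsFilter F) {x x' y y' : L} (hx : x' ⇨ x ∈ F) (hy : y ⇨ y' ∈ F) :
    (x ⇨ y) ⇨ (x' ⇨ y') ∈ F := by
  refine hF.mem_of_le (hF.mul_mem hy hx) (mul_le_iff.1 (mul_le_iff.1 ?_))
  calc (y ⇨ y') * (x' ⇨ x) * (x ⇨ y) * x'
      = (y ⇨ y') * ((x ⇨ y) * ((x' ⇨ x) * x')) := by
        rw [mul_assoc, mul_assoc, mul_left_comm (x' ⇨ x)]
    _ ≤ (y ⇨ y') * ((x ⇨ y) * x) := mul_mono_left _ (mul_mono_left _ (himp_mul_le _ _))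
    _ ≤ (y ⇨ y') * y := mul_mono_left _ (himp_mul_le _ _)
    _ ≤ y' := himp_mul_le _ _

/-- The quotient of a BL-algebra by a filter. -/
def Quo (hF : IsFilter F) : Type u := Quotient hF.setoid

instance instQuo (hF : IsFilter F) : BLAlgebra hF.Quo where
  mul := Quotient.map₂ (fun x y : L => x * y) fun _ _ h _ _ h' =>
    ⟨hF.mul_congr_mem h.1 h'.1, hF.mul_congr_mem h.2 h'.2⟩
  one := Quotient.mk hF.setoid 1
  zero := Quotient.mk hF.setoid 0
  himp := Quotient.map₂ (fun x y : L => x ⇨ y) fun _ _ h _ _ h' =>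
    ⟨hF.himp_congr_mem h.2 h'.1, hF.himp_congr_mem h.1 h'.2⟩
  mul_assoc := by
    rintro ⟨x⟩ ⟨y⟩ ⟨z⟩
    exact congrArg (Quotient.mk hF.setoid) (mul_assoc x y z)
  one_mul := by
    rintro ⟨x⟩
    exact congrArg (Quotient.mk hF.setoid) (one_mul x)
  mul_one := by
    rintro ⟨x⟩
    exact congrArg (Quotient.mk hF.setoid) (mul_one x)
  mul_comm := by
    rintro ⟨x⟩ ⟨y⟩
    exact congrArg (Quotient.mk hF.setoid) (mul_comm x y)
  himp_self := by
    rintro ⟨x⟩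
    exact congrArg (Quotient.mk hF.setoid) (BLAlgebra.himp_self x)
  mul_himp_comm := by
    rintro ⟨x⟩ ⟨y⟩
    exact congrArg (Quotient.mk hF.setoid) (BLAlgebra.mul_himp_comm x y)
  himp_himp := by
    rintro ⟨x⟩ ⟨y⟩ ⟨z⟩
    exact congrArg (Quotient.mk hF.setoid) (BLAlgebra.himp_himp x y z)
  zero_himp := by
    rintro ⟨x⟩
    exact congrArg (Quotient.mk hF.setoid) (BLAlgebra.zero_himp x)
  prelinear := by
    rintro ⟨x⟩ ⟨y⟩ ⟨z⟩
    exact congrArg (Quotient.mk hF.setoid) (BLAlgebra.prelinear x y z)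

/-- The quotient map. -/
def quoHom (hF : IsFilter F) : Hom L hF.Quo where
  toFun := Quotient.mk hF.setoid
  map_mul' _ _ := rfl
  map_himp' _ _ := rfl
  map_zero' := rfl

theorem quo_le_iff (hF : IsFilter F) (x y : L) :
    hF.quoHom.toFun x ≤ hF.quoHom.toFun y ↔ x ⇨ y ∈ F := by
  constructor
  · intro h
    have h1 : (Quotient.mk hF.setoid (x ⇨ y)) = Quotient.mk hF.setoid 1 := h
    have h2 := (Quotient.exact h1).2
    have h3 : (1 : L) ⇨ (x ⇨ y) ∈ F := h2
    rwa [one_himp'] at h3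
  · intro h
    have h1 : (Quotient.mk hF.setoid (x ⇨ y)) = Quotient.mk hF.setoid 1 := by
      apply Quotient.sound
      refine ⟨?_, ?_⟩
      · rw [himp_one']; exact hF.one_mem
      · rw [one_himp']; exact h
    exact h1

/-- The filter generated by a filter and an element. -/
theorem adjoin (hF : IsFilter F) (a : L) : IsFilter {t : L | ∃ n : ℕ, a ^ n ⇨ t ∈ F} where
  one_mem := ⟨0, by rw [himp_one']; exact hF.one_mem⟩
  mp := by
    rintro x y ⟨n, hn⟩ ⟨m, hm⟩
    refine ⟨m + n, ?_⟩
    rw [pow_add]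
    have h1 : (a ^ m * a ^ n) ⇨ ((x ⇨ y) * x) ∈ F := hF.mul_congr_mem hm hn
    refine hF.trans_mem h1 ?_
    rw [le_iff_himp.1 (himp_mul_le x y)]; exact hF.one_mem

theorem prime_aux (hF : IsFilter F) (a b : L)
    (hab : ∀ z, a ⇨ z ∈ F → b ⇨ z ∈ F → z ∈ F) (n m : ℕ) :
    ∀ z, a ^ n ⇨ z ∈ F → b ^ m ⇨ z ∈ F → z ∈ F := by
  have h1 : ∀ m : ℕ, ∀ z, a ⇨ z ∈ F → b ^ m ⇨ z ∈ F → z ∈ F := by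
    intro m
    induction m with
    | zero =>
      intro z _ h
      rwa [pow_zero, one_himp'] at h
    | succ m ih =>
      intro z h h'
      rw [pow_succ, mul_comm, ← himp_himp] at h'
      exact ih z h (hab _ (hF.mem_of_le h (himp_mono_right _ (le_himp_right _ _))) h')
  induction n with
  | zero =>
    intro z h _
    rwa [pow_zero, one_himp'] at h
  | succ n ih =>
    intro z h h'
    rw [pow_succ, mul_comm, ← himp_himp] at h
    exact ih z (h1 m _ h (hF.mem_of_le h' (himp_mono_right _ (le_himp_right _ _)))) h'

end IsFilter

theorem exists_prime_filter {t : L} (ht : t ≠ 1) :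
    ∃ F : Set L, IsFilter F ∧ t ∉ F ∧ ∀ x y : L, x ⇨ y ∈ F ∨ y ⇨ x ∈ F := by
  obtain ⟨F, -, hmax⟩ := zorn_subset_nonempty {F : Set L | IsFilter F ∧ t ∉ F}
    (by
      intro c hc hchain hne
      refine ⟨⋃₀ c, ⟨⟨?_, ?_⟩, ?_⟩, fun s hs => Set.subset_sUnion_of_mem hs⟩
      · obtain ⟨s, hs⟩ := hne
        exact ⟨s, hs, (hc hs).1.one_mem⟩
      · rintro x y ⟨s, hs, hx⟩ ⟨s', hs', hy⟩
        rcases hchain.total hs hs' with h | h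
        · exact ⟨s', hs', (hc hs').1.mp x y (h hx) hy⟩
        · exact ⟨s, hs, (hc hs).1.mp x y hx (h hy)⟩
      · rintro ⟨s, hs, h⟩
        exact (hc hs).2 h)
    {1} (by
      refine ⟨⟨rfl, ?_⟩, ht⟩
      rintro x y hx h
      rw [Set.mem_singleton_iff] at hx h ⊢
      rwa [hx, one_himp'] at h)
  obtain ⟨hF, htF⟩ := hmax.prop
  refine ⟨F, hF, htF, fun x y => ?_⟩
  by_contra hcon
  rw [not_or] at hcon
  have key : ∀ a : L, a ∉ F → ∃ n : ℕ, a ^ n ⇨ t ∈ F := by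
    intro a ha
    by_contra hn
    have hsub : F ⊆ {t : L | ∃ n : ℕ, a ^ n ⇨ t ∈ F} := fun z hz =>
      ⟨0, by rw [pow_zero, one_himp']; exact hz⟩
    have h2 := hmax.le_of_ge ⟨hF.adjoin a, hn⟩ hsub
    refine ha (h2 ⟨1, ?_⟩)
    rw [pow_one, himp_self]; exact hF.one_mem
  obtain ⟨n, hn⟩ := key _ hcon.1
  obtain ⟨m, hm⟩ := key _ hcon.2
  refine htF (hF.prime_aux (x ⇨ y) (y ⇨ x) ?_ n m t hn hm)
  intro z h1 h2
  exact hF.mp _ _ h2 (hF.mem_of_le h1 (le_iff_himp.2 (prelinear x y z)))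

/-- Inequalities in a BL-algebra may be checked in its nontrivial totally ordered images. -/
theorem le_of_chains {x y : L}
    (h : ∀ (C : Type u) [BLAlgebra C] (f : Hom L C), (∀ a b : C, a ≤ b ∨ b ≤ a) → (0 : C) ≠ 1 →
      f.toFun x ≤ f.toFun y) : x ≤ y := by
  by_contra hxy
  obtain ⟨F, hF, ht, hp⟩ := exists_prime_filter (t := x ⇨ y) hxy
  refine ht ((hF.quo_le_iff x y).1 (h hF.Quo hF.quoHom ?_ ?_))
  · rintro ⟨a⟩ ⟨b⟩
    rcases hp a b with h | h
    · exact Or.inl ((hF.quo_le_iff a b).2 h)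
    · exact Or.inr ((hF.quo_le_iff b a).2 h)
  · intro h01
    refine ht (hF.mem_of_le ?_ (zero_le' _))
    have h1 : hF.quoHom.toFun 1 ≤ hF.quoHom.toFun 0 := by
      rw [hF.quoHom.map_one', hF.quoHom.map_zero', h01]
    have h2 := (hF.quo_le_iff 1 0).1 h1
    rwa [one_himp'] at h2

theorem eq_of_chains {x y : L}
    (h : ∀ (C : Type u) [BLAlgebra C] (f : Hom L C), (∀ a b : C, a ≤ b ∨ b ≤ a) → (0 : C) ≠ 1 →
      f.toFun x = f.toFun y) : x = y :=
  le_antisymm (le_of_chains fun C _ f hc h0 => (h C f hc h0).le)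
    (le_of_chains fun C _ f hc h0 => (h C f hc h0).ge)

end Filters

section Add

variable {L : Type u} [BLAlgebra L]

/-- `(L, +, 0)` is a commutative monoid. -/
instance instAddCommMonoid : AddCommMonoid L where
  add_assoc x y z := eq_of_chains fun C _ f hc _ => by
    simp only [f.map_add']; exact chain_add_assoc hc _ _ _
  zero_add := zero_add'
  add_zero x := by rw [add_comm']; exact zero_add' x
  add_comm := add_comm'
  nsmul := nsmulRec

instance instIsOrderedAddMonoid : IsOrderedAddMonoid L where
  add_le_add_left _ _ h _ := add_mono' h le_rfl

theorem add_add_mul (x y : L) : x + y + x * y = x + y := eq_of_chains fun C _ f hc _ => by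
  simp only [f.map_add', f.map_mul']; exact chain_add_mul hc _ _

theorem cc_mul (x y : L) : (x * y)ᶜᶜ = xᶜᶜ * yᶜᶜ := eq_of_chains fun C _ f hc _ => by
  simp only [f.map_compl', f.map_mul']; exact chain_cc_mul hc _ _

theorem cc_himp (x y : L) : (x ⇨ y)ᶜᶜ = xᶜᶜ ⇨ yᶜᶜ := eq_of_chains fun C _ f hc _ => by
  simp only [f.map_compl', f.map_himp']; exact chain_cc_himp hc _ _

theorem cc_add (x y : L) : (x + y)ᶜᶜ = xᶜᶜ + yᶜᶜ := by
  simp only [add_def, inf_def, cc_mul, cc_himp, ccc]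

theorem cc_zero : (0 : L)ᶜᶜ = 0 := by rw [compl_zero', compl_one']

end Add

/-! ### Sequences and good sequences -/

section Seq

variable {L : Type u} [BLAlgebra L]

/-- The sum of two sequences. With entries indexed from `0`, the `n`-th entry is
`aₙ + (aₙ₋₁ ⊗ b₀) + ⋯ + (a₀ ⊗ bₙ₋₁) + bₙ`. -/
def seqAdd (a b : ℕ → L) (n : ℕ) : L :=
  a n + ∑ j ∈ Finset.range n, a (n - 1 - j) * b j + b n

theorem seqAdd_comm (a b : ℕ → L) : seqAdd a b = seqAdd b a := by
  funext n
  unfold seqAdd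
  have h : ∑ j ∈ Finset.range n, a (n - 1 - j) * b j = ∑ j ∈ Finset.range n, b (n - 1 - j) * a j := by
    rw [← Finset.sum_range_reflect]
    refine Finset.sum_congr rfl fun j hj => ?_
    rw [Finset.mem_range] at hj
    rw [mul_comm]
    congr 2
    omega
  rw [h, add_right_comm, add_comm (a n), add_right_comm]

theorem seqAdd_mono {a a' b b' : ℕ → L} (h : a ≤ a') (h' : b ≤ b') :
    seqAdd a b ≤ seqAdd a' b' := fun n =>
  add_le_add (add_le_add (h n) (Finset.sum_le_sum fun _ _ => mul_mono (h _) (h' _))) (h' n)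

theorem seqAdd_zero (a : ℕ → L) : seqAdd a 0 = a := by
  funext n
  simp [seqAdd, mul_zero']

theorem zero_seqAdd (a : ℕ → L) : seqAdd 0 a = a := by rw [seqAdd_comm, seqAdd_zero]

theorem map_sum' {C : Type u} [BLAlgebra C] (f : Hom L C) {ι : Type*} (s : Finset ι) (g : ι → L) :
    f.toFun (∑ i ∈ s, g i) = ∑ i ∈ s, f.toFun (g i) :=
  map_sum (AddMonoidHom.mk ⟨f.toFun, f.map_zero'⟩ f.map_add') g s

theorem map_seqAdd {C : Type u} [BLAlgebra C] (f : Hom L C) (a b : ℕ → L) :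
    f.toFun ∘ seqAdd a b = seqAdd (f.toFun ∘ a) (f.toFun ∘ b) := by
  funext n
  simp only [seqAdd, Function.comp_apply, f.map_add', map_sum', f.map_mul']

theorem cc_seqAdd (a b : ℕ → L) (n : ℕ) :
    (seqAdd a b n)ᶜᶜ = seqAdd (fun i => (a i)ᶜᶜ) (fun i => (b i)ᶜᶜ) n := by
  have h : (∑ j ∈ Finset.range n, a (n - 1 - j) * b j)ᶜᶜ
      = ∑ j ∈ Finset.range n, (a (n - 1 - j) * b j)ᶜᶜ :=
    map_sum (AddMonoidHom.mk ⟨fun x : L => xᶜᶜ, cc_zero⟩ cc_add) _ _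
  simp only [seqAdd, cc_add, h, cc_mul]

/-- A good sequence: `aᵢ + aᵢ₊₁ = aᵢ` for all `i`, and only finitely many entries are nonzero. -/
structure IsGood (a : ℕ → L) : Prop where
  add_succ : ∀ i, a i + a (i + 1) = a i
  eventually_zero : ∃ n, ∀ r, n ≤ r → a r = 0

/-- The sequence `(1ᵖ, a)`. -/
def onesThen (p : ℕ) (a : L) (n : ℕ) : L := if n < p then 1 else if n = p then a else 0

/-- The sequence `(1ᵖ, a, b)`. -/
def sq2 (p : ℕ) (a b : L) (n : ℕ) : L :=
  if n < p then 1 else if n = p then a else if n = p + 1 then b else 0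

theorem sq2_one (p : ℕ) (b : L) : sq2 p 1 b = onesThen (p + 1) b := by
  funext n
  unfold sq2 onesThen
  split_ifs <;> first | rfl | omega

theorem sq2_zero (p : ℕ) (a : L) : sq2 p a 0 = onesThen p a := by
  funext n
  unfold sq2 onesThen
  split_ifs <;> rfl

theorem sq_zero_zero : onesThen 0 (0 : L) = 0 := by
  funext n
  simp [onesThen]

theorem sq_zero_succ (p : ℕ) : onesThen (p + 1) (0 : L) = onesThen p 1 := by
  funext n
  unfold onesThen
  split_ifs <;> first | rfl | omega

theorem eq_one_of_sum {ι : Type*} {s : Finset ι} {g : ι → L} {i : ι} (hi : i ∈ s)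
    (h : g i = 1) : ∑ j ∈ s, g j = 1 := by
  classical
  rw [← Finset.add_sum_erase s g hi, h]
  exact one_add' _

theorem seqAdd_sq_eq_sum (p q : ℕ) (a b : L) (n : ℕ) :
    seqAdd (onesThen p a) (onesThen q b) n
      = ∑ j ∈ Finset.range (n + 2), onesThen (p + 1) a (n + 1 - j) * onesThen (q + 1) b j := by
  have h0 : ∀ (r : ℕ) (c : L), onesThen (r + 1) c 0 = 1 := fun r c => by simp [onesThen]
  have h1 : ∀ (r : ℕ) (c : L) (k : ℕ), onesThen (r + 1) c (k + 1) = onesThen r c k := fun r c k => by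
    simp [onesThen]
  rw [Finset.sum_range_succ, Finset.sum_range_succ', Nat.sub_self, h0, h0, h1, Nat.sub_zero, h1,
    one_mul, mul_one, seqAdd, add_comm (onesThen p a n)]
  congr 2
  refine Finset.sum_congr rfl fun j hj => ?_
  rw [Finset.mem_range] at hj
  rw [h1, ← h1 p a (n - 1 - j)]
  congr 2
  omega

theorem sq_add (p q : ℕ) (a b : L) :
    seqAdd (onesThen p a) (onesThen q b) = sq2 (p + q) (a + b) (a * b) := by
  have h1 : ∀ (r : ℕ) (c : L) (k : ℕ), k < r → onesThen r c k = 1 := fun r c k h => by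
    simp [onesThen, h]
  have h2 : ∀ (r : ℕ) (c : L), onesThen r c r = c := fun r c => by simp [onesThen]
  have h3 : ∀ (r : ℕ) (c : L) (k : ℕ), r < k → onesThen r c k = 0 := fun r c k h => by
    unfold onesThen
    rw [if_neg (by omega), if_neg (by omega)]
  funext n
  rw [seqAdd_sq_eq_sum]
  unfold sq2
  split_ifs with c1 c2 c3
  · refine eq_one_of_sum (i := min (n + 1) q) (Finset.mem_range.2 (by omega)) ?_
    rw [h1 _ _ _ (by omega), h1 _ _ _ (by omega), mul_one]
  · subst c2
    rw [Finset.sum_eq_add q (q + 1) (by omega), h2, h1 (q + 1) b q (by omega),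
      show p + q + 1 - q = p + 1 by omega, h2, h1 (p + 1) _ _ (by omega), one_mul, mul_one]
    · rintro j hj ⟨hj1, hj2⟩
      rw [Finset.mem_range] at hj
      rcases Nat.lt_or_ge j q with h | h
      · rw [h3 (p + 1) a _ (by omega), zero_mul']
      · rw [h3 (q + 1) b _ (by omega), mul_zero']
    · intro h; exact absurd (Finset.mem_range.2 (by omega)) h
    · intro h; exact absurd (Finset.mem_range.2 (by omega)) h
  · subst c3
    rw [Finset.sum_eq_single (q + 1), h2, show p + q + 1 + 1 - (q + 1) = p + 1 by omega, h2]
    · intro j hj hj1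
      rw [Finset.mem_range] at hj
      rcases Nat.lt_or_ge j (q + 1) with h | h
      · rw [h3 (p + 1) a _ (by omega), zero_mul']
      · rw [h3 (q + 1) b _ (by omega), mul_zero']
    · intro h; exact absurd (Finset.mem_range.2 (by omega)) h
  · refine Finset.sum_eq_zero fun j hj => ?_
    rw [Finset.mem_range] at hj
    rcases Nat.lt_or_ge j (q + 2) with h | h
    · rw [h3 (p + 1) a _ (by omega), zero_mul']
    · rw [h3 (q + 1) b _ (by omega), mul_zero']

theorem sq_isGood (p : ℕ) (a : L) : IsGood (onesThen p a) where
  add_succ i := by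
    unfold onesThen
    split_ifs <;> first | omega | simp [one_add']
  eventually_zero := ⟨p + 1, fun r hr => by
    unfold onesThen
    rw [if_neg (by omega), if_neg (by omega)]⟩

theorem sq_le_iff (h01 : (0 : L) ≠ 1) {p q : ℕ} {a b : L} (ha : a ≠ 0) :
    onesThen p a ≤ onesThen q b ↔ p < q ∨ (p = q ∧ a ≤ b) := by
  constructor
  · intro h
    rcases lt_trichotomy p q with h1 | h1 | h1
    · exact Or.inl h1
    · right
      refine ⟨h1, ?_⟩
      have := h p
      simpa [onesThen, h1] using this
    · exfalso
      have h2 := h (q + 1)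
      have h3 : onesThen q b (q + 1) = 0 := by simp [onesThen]
      rw [h3] at h2
      have h4 := eq_zero_of_le h2
      unfold onesThen at h4
      split_ifs at h4
      · exact h01 h4.symm
      · exact ha h4
      · omega
  · intro h n
    unfold onesThen
    split_ifs <;> first | exact le_one' _ | exact zero_le' _ | omega | skip
    rcases h with h | h
    · omega
    · exact h.2

end Seq

section ChainSeq

variable {C : Type u} [BLAlgebra C]

theorem chain_add_eq_self (hc : ∀ x y : C, x ≤ y ∨ y ≤ x) {x y : C} (h : x + y = x)
    (hx1 : x ≠ 1) : y = 0 := by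
  by_contra hy0
  have hx0 : x ≠ 0 := by
    rintro rfl
    rw [zero_add] at h; exact hy0 h
  rcases chain_dichotomy hc x with hx | hx
  · rcases chain_dichotomy hc y with hy | hy
    · have h1 : x * y = 0 := by
        rcases chain_mul_eq_zero hc x y with h1 | h1
        · exact absurd (h.symm.trans h1) hx1
        · exact h1
      refine hy0 (eq_zero_of_le ?_)
      refine chain_reg_cancel hc hy (by rw [compl_zero', compl_one']) hx ?_ ?_
      · rw [zero_add, add_comm, h]
      · rw [mul_comm, h1, zero_mul']
    · rw [add_comm, chain_add_dense hc hy hx0] at h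
      exact hx1 h.symm
  · rw [chain_add_dense hc hx hy0] at h
    exact hx1 h.symm

/-- Good sequences of a BL-chain. -/
theorem chain_good_form (hc : ∀ x y : C, x ≤ y ∨ y ≤ x) {a : ℕ → C} (ha : IsGood a) :
    a = 0 ∨ ∃ p c, c ≠ 0 ∧ a = onesThen p c := by
  classical
  obtain ⟨N, hN⟩ := ha.eventually_zero
  have hex : ∃ n, a n = 0 := ⟨N, hN N le_rfl⟩
  -- the first zero entry
  let m := Nat.find hex
  have hm : a m = 0 := Nat.find_spec hex
  have hlt : ∀ i, i < m → a i ≠ 0 := fun i hi => Nat.find_min hex hi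
  have hone : ∀ i, i + 1 < m → a i = 1 := by
    intro i hi
    by_contra h1
    exact hlt _ hi (chain_add_eq_self hc (ha.add_succ i) h1)
  have hzero : ∀ i, m ≤ i → a i = 0 := by
    intro i hi
    induction i, hi using Nat.le_induction with
    | base => exact hm
    | succ i _ ih =>
      have := ha.add_succ i
      rwa [ih, zero_add] at this
  rcases Nat.eq_zero_or_pos m with h | h
  · left
    funext i
    exact hzero i (by omega)
  · right
    refine ⟨m - 1, a (m - 1), hlt _ (by omega), ?_⟩
    funext i
    unfold onesThen
    split_ifs with h1 h2
    · exact hone i (by omega)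
    · rw [h2]
    · exact hzero i (by omega)

theorem chain_seqAdd_isGood (hc : ∀ x y : C, x ≤ y ∨ y ≤ x) {a b : ℕ → C} (ha : IsGood a)
    (hb : IsGood b) : IsGood (seqAdd a b) := by
  rcases chain_good_form hc ha with rfl | ⟨p, x, -, rfl⟩
  · rwa [zero_seqAdd]
  rcases chain_good_form hc hb with rfl | ⟨q, y, -, rfl⟩
  · rwa [seqAdd_zero]
  rw [sq_add]
  rcases chain_mul_eq_zero hc x y with h | h
  · rw [h, sq2_one]; exact sq_isGood _ _
  · rw [h, sq2_zero]; exact sq_isGood _ _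

end ChainSeq

/-! ### Comparison of sums of good sequences -/

section ChainCompare

variable {C : Type u} [BLAlgebra C]

/-- The double complement of a sequence. -/
def ccSeq (x : ℕ → C) (i : ℕ) : C := (x i)ᶜᶜ

theorem ccSeq_mono {x y : ℕ → C} (h : x ≤ y) : ccSeq x ≤ ccSeq y := fun i =>
  compl_anti (compl_anti (h i))

theorem ccSeq_add (x y : ℕ → C) : ccSeq (seqAdd x y) = seqAdd (ccSeq x) (ccSeq y) := by
  funext n
  exact cc_seqAdd x y n

theorem ccSeq_good {x : ℕ → C} (h : IsGood x) : IsGood (ccSeq x) where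
  add_succ i := by
    unfold ccSeq
    rw [← cc_add, h.add_succ]
  eventually_zero := by
    obtain ⟨n, hn⟩ := h.eventually_zero
    exact ⟨n, fun r hr => by unfold ccSeq; rw [hn r hr, cc_zero]⟩

theorem ccSeq_ccSeq (x : ℕ → C) : ccSeq (ccSeq x) = ccSeq x := by
  funext i
  exact ccc _

theorem good_form' (hc : ∀ x y : C, x ≤ y ∨ y ≤ x) {a : ℕ → C} (ha : IsGood a) :
    ∃ p c, a = onesThen p c := by
  rcases chain_good_form hc ha with h | ⟨p, c, -, h⟩
  · exact ⟨0, 0, h.trans sq_zero_zero.symm⟩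
  · exact ⟨p, c, h⟩

theorem good_form_ne_one (hc : ∀ x y : C, x ≤ y ∨ y ≤ x) (h01 : (0 : C) ≠ 1) {a : ℕ → C}
    (ha : IsGood a) : ∃ p c, c ≠ 1 ∧ a = onesThen p c := by
  obtain ⟨p, c, h⟩ := good_form' hc ha
  by_cases h1 : c = 1
  · exact ⟨p + 1, 0, h01, by rw [h, h1, sq_zero_succ]⟩
  · exact ⟨p, c, h1, h⟩

theorem reg_entry {p : ℕ} {c : C} (h : ccSeq (onesThen p c) = onesThen p c) : cᶜᶜ = c := by
  have := congrFun h p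
  simpa [ccSeq, onesThen] using this

/-- `(1ⁿ, a, b, c)`. -/
def sq3 (p : ℕ) (a b c : C) (n : ℕ) : C :=
  if n < p then 1 else if n = p then a else if n = p + 1 then b else if n = p + 2 then c else 0

theorem sq3_left (hc : ∀ x y : C, x ≤ y ∨ y ≤ x) (p q r : ℕ) (a b c : C) :
    seqAdd (seqAdd (onesThen p a) (onesThen q b)) (onesThen r c)
      = sq3 (p + q + r) (a + b + c) (a * b + (a + b) * c) (a * b * c) := by
  rw [sq_add]
  rcases chain_mul_eq_zero hc a b with h | h
  · rw [h, sq2_one, sq_add, one_add', one_mul]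
    funext n
    unfold sq2 sq3
    split_ifs <;> first | rfl | omega
  · rw [h, sq2_zero, sq_add, zero_add, zero_mul']
    funext n
    unfold sq2 sq3
    split_ifs <;> rfl

theorem reg_assoc (hc : ∀ x y : C, x ≤ y ∨ y ≤ x) {x y z : ℕ → C} (hx : IsGood x)
    (hy : IsGood y) (hz : IsGood z) (hx' : ccSeq x = x) (hy' : ccSeq y = y)
    (hz' : ccSeq z = z) : seqAdd (seqAdd x y) z = seqAdd x (seqAdd y z) := by
  obtain ⟨p, a, rfl⟩ := good_form' hc hx
  obtain ⟨q, b, rfl⟩ := good_form' hc hy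
  obtain ⟨r, c, rfl⟩ := good_form' hc hz
  rw [seqAdd_comm (onesThen p a) (seqAdd _ _), sq3_left hc, sq3_left hc]
  have h1 := chain_idass hc (reg_entry hy') (reg_entry hx') (reg_entry hz')
  rw [mul_comm a b, add_comm a b, h1]
  congr 1
  · omega
  · rw [add_right_comm]
  · rw [mul_right_comm]

theorem reg_cancel (hc : ∀ x y : C, x ≤ y ∨ y ≤ x) (h01 : (0 : C) ≠ 1) {x y k : ℕ → C}
    (hx : IsGood x) (hy : IsGood y) (hk : IsGood k) (hx' : ccSeq x = x) (hy' : ccSeq y = y)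
    (hk' : ccSeq k = k) (h : seqAdd x k ≤ seqAdd y k) : x ≤ y := by
  rcases chain_good_form hc hx with rfl | ⟨p, a, ha, rfl⟩
  · exact fun i => zero_le' _
  obtain ⟨q, b, hb, rfl⟩ := good_form_ne_one hc h01 hy
  obtain ⟨r, c, rfl⟩ := good_form' hc hk
  rw [sq_le_iff h01 ha]
  rw [sq_add, sq_add] at h
  rcases lt_trichotomy p q with h1 | h1 | h1
  · exact Or.inl h1
  · right
    refine ⟨h1, ?_⟩
    subst h1
    have e1 := h (p + r)
    have e2 := h (p + r + 1)
    simp only [sq2, lt_irrefl, if_false, if_true] at e1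
    have e2' : a * c ≤ b * c := by
      unfold sq2 at e2
      rwa [if_neg (by omega), if_neg (by omega), if_pos rfl, if_neg (by omega), if_neg (by omega),
        if_pos rfl] at e2
    exact chain_reg_cancel hc (reg_entry hx') (reg_entry hy') (reg_entry hk') e1 e2'
  · exfalso
    have e1 := h (q + r)
    have e2 := h (q + r + 1)
    unfold sq2 at e1 e2
    rw [if_pos (by omega), if_neg (by omega), if_pos rfl] at e1
    rw [if_neg (c := q + r + 1 < q + r) (by omega), if_neg (c := q + r + 1 = q + r) (by omega),
      if_pos (c := q + r + 1 = q + r + 1) rfl] at e2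
    split_ifs at e2 with c1 c2
    · exact hb (eq_one_of_ge (e2.trans (mul_le_left' b c)))
    · have e3 : c ≤ b * c := by
        refine le_trans ?_ e2
        rw [add_comm]
        exact le_add_left' c a
      have e4 : c * b = c := by
        rw [mul_comm]
        exact le_antisymm (mul_le_right' b c) e3
      have e5 : cᶜ ≤ b := by
        refine compl_le_of_add_eq_one ?_
        rw [add_comm]; exact eq_one_of_ge e1
      have e6 := chain_himp_mul hc (reg_entry hk') (reg_entry hy') e5
      rw [e4, himp_self] at e6
      exact hb e6.symm
    all_goals omega

/-- Regular elements other than `0` and `1`. -/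
def Mid (m : C) : Prop := mᶜᶜ = m ∧ m ≠ 0 ∧ m ≠ 1

/-- Good sequences of the form `(0)` or `(1ᵖ, a)` with `a` dense and `m ≤ a`. -/
def DForm (m : C) (x : ℕ → C) : Prop := x = 0 ∨ ∃ p a, aᶜ = 0 ∧ m ≤ a ∧ x = onesThen p a

/-- `m` is a witness for `x`. -/
def Wit (m : C) (x : ℕ → C) : Prop := Mid m ∨ (mᶜ = 0 ∧ DForm m x)

theorem Wit.mono (hc : ∀ x y : C, x ≤ y ∨ y ≤ x) {m m' : C} {x : ℕ → C} (h : Wit m x)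
    (hm : m' ≤ m) (h0 : m' ≠ 0) : Wit m' x := by
  by_cases h1 : m' = 1
  · have : m = 1 := eq_one_of_ge (h1 ▸ hm)
    rw [h1, ← this]; exact h
  rcases chain_dichotomy hc m' with hd | hd
  · exact Or.inl ⟨hd, h0, h1⟩
  · right
    refine ⟨hd, ?_⟩
    rcases h with h | ⟨-, h⟩
    · exfalso
      have h2 : mᶜ = 0 := eq_zero_of_le ((compl_anti hm).trans hd.le)
      refine h.2.2 ?_
      rw [← h.1, h2, compl_zero']
    · rcases h with h | ⟨p, a, h2, h3, h4⟩
      · exact Or.inl h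
      · exact Or.inr ⟨p, a, h2, hm.trans h3, h4⟩

theorem dense_mul {a b : C} (ha : aᶜ = 0) (hb : bᶜ = 0) : (a * b)ᶜ = 0 := by
  rw [← himp_compl, hb]; exact ha

theorem dense_ne_zero (h01 : (0 : C) ≠ 1) {a : C} (ha : aᶜ = 0) : a ≠ 0 := by
  rintro rfl
  rw [compl_zero'] at ha
  exact h01 ha.symm

theorem dense_sq_add (hc : ∀ x y : C, x ≤ y ∨ y ≤ x) (h01 : (0 : C) ≠ 1) {a b : C} (p q : ℕ)
    (ha : aᶜ = 0) (hb : bᶜ = 0) : seqAdd (onesThen p a) (onesThen q b) = onesThen (p + q + 1) (a * b) := by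
  rw [sq_add, chain_add_dense hc ha (dense_ne_zero h01 hb), sq2_one]

theorem dense_assoc (hc : ∀ x y : C, x ≤ y ∨ y ≤ x) (h01 : (0 : C) ≠ 1) {m m' m'' : C}
    {x y z : ℕ → C} (hx : DForm m x) (hy : DForm m' y) (hz : DForm m'' z) :
    seqAdd (seqAdd x y) z = seqAdd x (seqAdd y z) := by
  rcases hx with rfl | ⟨p, a, ha, -, rfl⟩
  · rw [zero_seqAdd, zero_seqAdd]
  rcases hy with rfl | ⟨q, b, hb, -, rfl⟩
  · rw [zero_seqAdd, seqAdd_zero]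
  rcases hz with rfl | ⟨r, c, hcc, -, rfl⟩
  · rw [seqAdd_zero, seqAdd_zero]
  rw [dense_sq_add hc h01 _ _ ha hb, dense_sq_add hc h01 _ _ hb hcc,
    dense_sq_add hc h01 _ _ (dense_mul ha hb) hcc, dense_sq_add hc h01 _ _ ha (dense_mul hb hcc),
    mul_assoc]
  congr 1
  omega

theorem mid_absorb (hc : ∀ x y : C, x ≤ y ∨ y ≤ x) {m : C} (hm : Mid m)
    {x : ℕ → C} (hx : IsGood x) : seqAdd x (onesThen 0 m) = seqAdd (ccSeq x) (onesThen 0 m) := by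
  rcases chain_good_form hc hx with rfl | ⟨p, a, ha, rfl⟩
  · congr 1
    funext i
    exact cc_zero.symm
  have h1 : ccSeq (onesThen p a) = onesThen p (aᶜᶜ) := by
    funext i
    unfold ccSeq onesThen
    split_ifs
    · rw [compl_one', compl_zero']
    · rfl
    · exact cc_zero
  rw [h1]
  rcases chain_dichotomy hc a with h | h
  · rw [h]
  · rw [h, compl_zero', sq_add, sq_add, chain_add_dense hc h hm.2.1, one_add', one_mul, mul_comm,
      (chain_absorb hc hm.1 hm.2.2 h).2]

theorem cc_cancel (hc : ∀ x y : C, x ≤ y ∨ y ≤ x) (h01 : (0 : C) ≠ 1) {x y k : ℕ → C}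
    (hx : IsGood x) (hy : IsGood y) (hk : IsGood k) (h : seqAdd x k ≤ seqAdd y k) :
    ccSeq x ≤ ccSeq y := by
  refine reg_cancel hc h01 (ccSeq_good hx) (ccSeq_good hy) (ccSeq_good hk) (ccSeq_ccSeq _)
    (ccSeq_ccSeq _) (ccSeq_ccSeq _) ?_
  rw [← ccSeq_add, ← ccSeq_add]
  exact ccSeq_mono h

theorem chain_move (hc : ∀ x y : C, x ≤ y ∨ y ≤ x) (h01 : (0 : C) ≠ 1) {x y k : ℕ → C}
    (hx : IsGood x) (hy : IsGood y) (hk : IsGood k) {m : C} (wx : Wit m x) (wy : Wit m y)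
    (wk : Wit m k) (h : seqAdd x k ≤ seqAdd y k) : seqAdd x (onesThen 0 m) ≤ seqAdd y (onesThen 0 m) := by
  by_cases hm : Mid m
  · rw [mid_absorb hc hm hx, mid_absorb hc hm hy]
    exact seqAdd_mono (cc_cancel hc h01 hx hy hk h) le_rfl
  obtain ⟨hd, dx⟩ := wx.resolve_left hm
  obtain ⟨-, dy⟩ := wy.resolve_left hm
  obtain ⟨-, dk⟩ := wk.resolve_left hm
  rcases dk with rfl | ⟨r, d, hdd, hmd, rfl⟩
  · rw [seqAdd_zero, seqAdd_zero] at h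
    exact seqAdd_mono h le_rfl
  rcases dx with rfl | ⟨p, a, ha, -, rfl⟩
  · exact seqAdd_mono (fun i => zero_le' _) le_rfl
  rw [dense_sq_add hc h01 _ _ ha hdd] at h
  rcases dy with rfl | ⟨q, b, hb, -, rfl⟩
  · rw [zero_seqAdd, sq_le_iff h01 (dense_ne_zero h01 (dense_mul ha hdd))] at h
    omega
  rw [dense_sq_add hc h01 _ _ hb hdd, sq_le_iff h01 (dense_ne_zero h01 (dense_mul ha hdd))] at h
  rw [dense_sq_add hc h01 _ _ ha hd, dense_sq_add hc h01 _ _ hb hd,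
    sq_le_iff h01 (dense_ne_zero h01 (dense_mul ha hd))]
  rcases h with h | ⟨h, h'⟩
  · left; omega
  · right
    refine ⟨by omega, ?_⟩
    have e : m = d * (d ⇨ m) := by rw [mul_himp_comm, le_iff_himp.1 hmd, mul_one]
    rw [e, ← mul_assoc, ← mul_assoc]
    exact mul_mono_right _ h'

theorem chain_assoc (hc : ∀ x y : C, x ≤ y ∨ y ≤ x) (h01 : (0 : C) ≠ 1) {x y z : ℕ → C}
    (hx : IsGood x) (hy : IsGood y) (hz : IsGood z) {m : C} (wx : Wit m x) (wy : Wit m y)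
    (wz : Wit m z) :
    seqAdd (seqAdd (seqAdd x y) z) (onesThen 0 m) = seqAdd (seqAdd x (seqAdd y z)) (onesThen 0 m) := by
  by_cases hm : Mid m
  · rw [mid_absorb hc hm (chain_seqAdd_isGood hc (chain_seqAdd_isGood hc hx hy) hz),
      mid_absorb hc hm (chain_seqAdd_isGood hc hx (chain_seqAdd_isGood hc hy hz))]
    simp only [ccSeq_add]
    rw [reg_assoc hc (ccSeq_good hx) (ccSeq_good hy) (ccSeq_good hz) (ccSeq_ccSeq _)
      (ccSeq_ccSeq _) (ccSeq_ccSeq _)]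
  · rw [dense_assoc hc h01 (wx.resolve_left hm).2 (wy.resolve_left hm).2 (wz.resolve_left hm).2]

theorem chain_add_right (hc : ∀ x y : C, x ≤ y ∨ y ≤ x) (h01 : (0 : C) ≠ 1) {x y z k : ℕ → C}
    (hx : IsGood x) (hy : IsGood y) (hz : IsGood z) (hk : IsGood k) {m : C} (wx : Wit m x)
    (wy : Wit m y) (wz : Wit m z) (wk : Wit m k) (h : seqAdd x k ≤ seqAdd y k) :
    seqAdd (seqAdd x z) (onesThen 0 m) ≤ seqAdd (seqAdd y z) (onesThen 0 m) := by
  by_cases hm : Mid m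
  · rw [mid_absorb hc hm (chain_seqAdd_isGood hc hx hz),
      mid_absorb hc hm (chain_seqAdd_isGood hc hy hz), ccSeq_add, ccSeq_add]
    exact seqAdd_mono (seqAdd_mono (cc_cancel hc h01 hx hy hk h) le_rfl) le_rfl
  · have h1 := chain_move hc h01 hx hy hk wx wy wk h
    have dm : DForm m (onesThen 0 m) := Or.inr ⟨0, m, (wx.resolve_left hm).1, le_rfl, rfl⟩
    have e : ∀ w : ℕ → C, DForm m w →
        seqAdd (seqAdd w z) (onesThen 0 m) = seqAdd (seqAdd w (onesThen 0 m)) z := fun w hw => by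
      rw [dense_assoc hc h01 hw (wz.resolve_left hm).2 dm, seqAdd_comm z,
        dense_assoc hc h01 hw dm (wz.resolve_left hm).2]
    rw [e x (wx.resolve_left hm).2, e y (wy.resolve_left hm).2]
    exact seqAdd_mono h1 le_rfl

theorem chain_cancel (hc : ∀ x y : C, x ≤ y ∨ y ≤ x) (h01 : (0 : C) ≠ 1) {x y z k : ℕ → C}
    (hx : IsGood x) (hy : IsGood y) (hz : IsGood z) (hk : IsGood k) {m : C} (wx : Wit m x)
    (wy : Wit m y) (wz : Wit m z) (wk : Wit m k) (wzk : Wit m (seqAdd z k))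
    (h : seqAdd (seqAdd x z) k ≤ seqAdd (seqAdd y z) k) :
    seqAdd x (onesThen 0 m) ≤ seqAdd y (onesThen 0 m) := by
  by_cases hm : Mid m
  · rw [mid_absorb hc hm hx, mid_absorb hc hm hy]
    have h1 := cc_cancel hc h01 (chain_seqAdd_isGood hc hx hz) (chain_seqAdd_isGood hc hy hz) hk h
    rw [ccSeq_add, ccSeq_add] at h1
    exact seqAdd_mono (reg_cancel hc h01 (ccSeq_good hx) (ccSeq_good hy) (ccSeq_good hz)
      (ccSeq_ccSeq _) (ccSeq_ccSeq _) (ccSeq_ccSeq _) h1) le_rfl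
  · rw [dense_assoc hc h01 (wx.resolve_left hm).2 (wz.resolve_left hm).2 (wk.resolve_left hm).2,
      dense_assoc hc h01 (wy.resolve_left hm).2 (wz.resolve_left hm).2 (wk.resolve_left hm).2] at h
    exact chain_move hc h01 hx hy (chain_seqAdd_isGood hc hz hk) wx wy wzk h

/-- A term for `x ∨ x̄`. -/
def jn (x : C) : C := ((x ⇨ xᶜ) ⇨ xᶜ) ⊓ ((xᶜ ⇨ x) ⇨ x)

theorem jn_dense {x : C} (h : xᶜ = 0) : jn x = x := by
  have h0 : x ⇨ (0 : C) = 0 := h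
  unfold jn
  rw [h, h0, himp_self, zero_himp, one_himp']
  exact inf_eq_right.2 (le_one' x)

theorem jn_zero : jn (0 : C) = 1 := by
  unfold jn
  rw [zero_himp, compl_zero', himp_self, one_himp', himp_self]
  exact inf_idem _

theorem jn_mid (hc : ∀ x y : C, x ≤ y ∨ y ≤ x) {x : C} (h : Mid x) : Mid (jn x) := by
  rcases hc x xᶜ with h1 | h1
  · have e : jn x = xᶜ := by
      unfold jn
      rw [le_iff_himp.1 h1, one_himp']
      refine inf_eq_left.2 (mul_le_iff.1 ?_)
      rw [mul_comm]; exact himp_mul_le _ _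
    rw [e]
    refine ⟨ccc x, fun h0 => h.2.2 ?_, fun h0 => h.2.1 (eq_zero_of_compl h0)⟩
    rw [← h.1, h0, compl_zero']
  · have e : jn x = x := by
      unfold jn
      rw [le_iff_himp.1 h1, one_himp']
      refine inf_eq_right.2 (mul_le_iff.1 ?_)
      rw [mul_comm]; exact himp_mul_le _ _
    rw [e]; exact h

end ChainCompare

section Witness

variable {L : Type u} [BLAlgebra L]

/-- Approximate witness. -/
def witAux (x : ℕ → L) : ℕ → L
  | 0 => 1
  | n + 1 => witAux x n ⊓ jn (x n)

theorem witAux_spec {C : Type u} [BLAlgebra C] (f : Hom L C) (hc : ∀ x y : C, x ≤ y ∨ y ≤ x)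
    (x : ℕ → L) (N : ℕ) :
    (∀ j < N, f.toFun (witAux x N) ≤ jn (f.toFun (x j))) ∧
      (f.toFun (witAux x N) = 1 ∨ ∃ j < N, f.toFun (witAux x N) = jn (f.toFun (x j))) := by
  have hj : ∀ y : L, f.toFun (jn y) = jn (f.toFun y) := fun y => by
    simp only [jn, f.map_inf', f.map_himp', f.map_compl']
  induction N with
  | zero => exact ⟨fun j hj => absurd hj (Nat.not_lt_zero j), Or.inl f.map_one'⟩
  | succ N ih =>
    have e : f.toFun (witAux x (N + 1)) = f.toFun (witAux x N) ⊓ jn (f.toFun (x N)) := by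
      rw [witAux, f.map_inf', hj]
    rw [e]
    constructor
    · intro j hjN
      rcases Nat.lt_succ_iff_lt_or_eq.1 hjN with h | h
      · exact inf_le_left.trans (ih.1 j h)
      · rw [h]; exact inf_le_right
    · rcases hc (f.toFun (witAux x N)) (jn (f.toFun (x N))) with h | h
      · rw [inf_eq_left.2 h]
        rcases ih.2 with h' | ⟨j, hj, h'⟩
        · exact Or.inl h'
        · exact Or.inr ⟨j, by omega, h'⟩
      · rw [inf_eq_right.2 h]
        exact Or.inr ⟨N, by omega, rfl⟩

theorem IsGood.map {C : Type u} [BLAlgebra C] (f : Hom L C) {x : ℕ → L} (hx : IsGood x) :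
    IsGood (f.toFun ∘ x) where
  add_succ i := by
    rw [Function.comp_apply, Function.comp_apply, ← f.map_add', hx.add_succ]
  eventually_zero := by
    obtain ⟨n, hn⟩ := hx.eventually_zero
    exact ⟨n, fun r hr => by rw [Function.comp_apply, hn r hr, f.map_zero']⟩

theorem exists_wit_one {x : ℕ → L} (hx : IsGood x) :
    ∃ m : L, ∀ (C : Type u) [BLAlgebra C] (f : Hom L C), (∀ a b : C, a ≤ b ∨ b ≤ a) →
      (0 : C) ≠ 1 → f.toFun m ≠ 0 ∧ Wit (f.toFun m) (f.toFun ∘ x) := by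
  obtain ⟨N, hN⟩ := hx.eventually_zero
  refine ⟨witAux x N, fun C _ f hc h01 => ?_⟩
  obtain ⟨h1, h2⟩ := witAux_spec f hc x N
  generalize f.toFun (witAux x N) = m at h1 h2
  rcases chain_good_form hc (hx.map f) with h | ⟨p, a, ha, h⟩
  · have hm : m = 1 := by
      rcases h2 with h2 | ⟨j, -, h2⟩
      · exact h2
      · have := congrFun h j
        rw [Function.comp_apply] at this
        rw [h2, this]; exact jn_zero
    rw [hm]
    exact ⟨h01.symm, Or.inr ⟨compl_one', Or.inl h⟩⟩
  · have hent : ∀ j, f.toFun (x j) = onesThen p a j := fun j => congrFun h j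
    have hp : p < N := by
      by_contra hp
      have := hent p
      rw [hN p (by omega), f.map_zero'] at this
      exact ha (by simpa [onesThen] using this.symm)
    have hpj := h1 p hp
    have hpa : f.toFun (x p) = a := by rw [hent]; simp [onesThen]
    rw [hpa] at hpj
    have h3 : m = 1 ∨ m = jn a := by
      rcases h2 with h2 | ⟨j, -, h2⟩
      · exact Or.inl h2
      · rw [hent j] at h2
        unfold onesThen at h2
        split_ifs at h2
        · left; rw [h2]; exact jn_dense compl_one'
        · exact Or.inr h2
        · left; rw [h2]; exact jn_zero
    by_cases had : aᶜ = 0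
    · rw [jn_dense had] at hpj h3
      have hmd : mᶜ = 0 := by
        rcases h3 with h3 | h3
        · rw [h3]; exact compl_one'
        · rw [h3]; exact had
      exact ⟨dense_ne_zero h01 hmd, Or.inr ⟨hmd, Or.inr ⟨p, a, had, hpj, h⟩⟩⟩
    · have hmid : Mid a := by
        refine ⟨(chain_dichotomy hc a).resolve_right had, ha, ?_⟩
        rintro rfl
        exact had compl_one'
      have hj := jn_mid hc hmid
      have hmj : m = jn a := by
        rcases h3 with h3 | h3
        · exact absurd (eq_one_of_ge (h3 ▸ hpj)) hj.2.2
        · exact h3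
      rw [hmj]
      exact ⟨hj.2.1, Or.inl hj⟩

theorem exists_wit (l : List (ℕ → L)) (hl : ∀ x ∈ l, IsGood x) :
    ∃ m : L, ∀ (C : Type u) [BLAlgebra C] (f : Hom L C), (∀ a b : C, a ≤ b ∨ b ≤ a) →
      (0 : C) ≠ 1 → f.toFun m ≠ 0 ∧ ∀ x ∈ l, Wit (f.toFun m) (f.toFun ∘ x) := by
  induction l with
  | nil =>
    exact ⟨1, fun C _ f _ h01 => ⟨by rw [f.map_one']; exact h01.symm, by simp⟩⟩
  | cons x l ih =>
    obtain ⟨m, hm⟩ := ih fun y hy => hl y (List.mem_cons_of_mem _ hy)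
    obtain ⟨m', hm'⟩ := exists_wit_one (hl x List.mem_cons_self)
    refine ⟨m ⊓ m', fun C _ f hc h01 => ?_⟩
    obtain ⟨h1, h2⟩ := hm C f hc h01
    obtain ⟨h1', h2'⟩ := hm' C f hc h01
    have h0 : f.toFun (m ⊓ m') ≠ 0 := by
      rw [f.map_inf']
      rcases hc (f.toFun m) (f.toFun m') with h | h
      · rw [inf_eq_left.2 h]; exact h1
      · rw [inf_eq_right.2 h]; exact h1'
    refine ⟨h0, fun y hy => ?_⟩
    rcases List.mem_cons.1 hy with rfl | hy
    · exact h2'.mono hc (by rw [f.map_inf']; exact inf_le_right) h0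
    · exact (h2 y hy).mono hc (by rw [f.map_inf']; exact inf_le_left) h0

theorem seq_le_of_chains {x y : ℕ → L}
    (h : ∀ (C : Type u) [BLAlgebra C] (f : Hom L C), (∀ a b : C, a ≤ b ∨ b ≤ a) → (0 : C) ≠ 1 →
      f.toFun ∘ x ≤ f.toFun ∘ y) : x ≤ y := fun i =>
  le_of_chains fun C _ f hc h01 => h C f hc h01 i

theorem map_sq {C : Type u} [BLAlgebra C] (f : Hom L C) (p : ℕ) (a : L) :
    f.toFun ∘ onesThen p a = onesThen p (f.toFun a) := by
  funext i
  simp only [Function.comp_apply, onesThen]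
  split_ifs
  · exact f.map_one'
  · rfl
  · exact f.map_zero'

theorem Hom.mono {C : Type u} [BLAlgebra C] (f : Hom L C) {x y : L} (h : x ≤ y) :
    f.toFun x ≤ f.toFun y := by
  rw [le_iff_himp, ← f.map_himp', le_iff_himp.1 h, f.map_one']

theorem Hom.mono_seq {C : Type u} [BLAlgebra C] (f : Hom L C) {x y : ℕ → L} (h : x ≤ y) :
    f.toFun ∘ x ≤ f.toFun ∘ y := fun i => f.mono (h i)

/-- The sum of two good sequences is a good sequence. -/
theorem IsGood.seqAdd {x y : ℕ → L} (hx : IsGood x) (hy : IsGood y) : IsGood (seqAdd x y) where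
  add_succ i := eq_of_chains fun C _ f hc _ => by
    have h := (chain_seqAdd_isGood hc (hx.map f) (hy.map f)).add_succ i
    rw [← map_seqAdd, Function.comp_apply, Function.comp_apply] at h
    rw [f.map_add']; exact h
  eventually_zero := by
    obtain ⟨n, hn⟩ := hx.eventually_zero
    obtain ⟨m, hm⟩ := hy.eventually_zero
    refine ⟨n + m + 1, fun r hr => ?_⟩
    unfold BLAlgebra.seqAdd
    rw [hn r (by omega), hm r (by omega), Finset.sum_eq_zero, add_zero, add_zero]
    intro j hj
    rw [Finset.mem_range] at hj
    rcases Nat.lt_or_ge j m with h | h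
    · rw [hn _ (by omega), zero_mul']
    · rw [hm j h, mul_zero']

end Witness

/-! ### Good sequences and the Chang group -/

/-- The set `M_L` of good sequences of `L`. -/
def GoodSeq (L : Type u) [BLAlgebra L] : Type u := {a : ℕ → L // IsGood a}

namespace GoodSeq

variable {L : Type u} [BLAlgebra L]

/-- The order of good sequences is componentwise: `a ≤ b` when `aᵢ ≤ bᵢ` for all `i`. -/
instance instPartialOrder : PartialOrder (GoodSeq L) :=
  inferInstanceAs (PartialOrder {a : ℕ → L // IsGood a})

/-- The addition of good sequences. -/
instance instAdd : Add (GoodSeq L) := ⟨fun a b => ⟨seqAdd a.1 b.1, a.2.seqAdd b.2⟩⟩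

/-- The good sequence `(0)`. -/
instance instZero : Zero (GoodSeq L) := ⟨⟨0, fun _ => add_zero 0, 0, fun _ _ => rfl⟩⟩

/-- The good sequence `(a)`. -/
def single (a : L) : GoodSeq L := ⟨onesThen 0 a, sq_isGood 0 a⟩

theorem add_comm' (a b : GoodSeq L) : a + b = b + a := Subtype.ext (seqAdd_comm a.1 b.1)

theorem add_zero' (a : GoodSeq L) : a + 0 = a := Subtype.ext (seqAdd_zero a.1)

theorem add_mono' {a b c d : GoodSeq L} (h : a ≤ b) (h' : c ≤ d) : a + c ≤ b + d :=
  seqAdd_mono h h'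

theorem exists_wit' (l : List (GoodSeq L)) :
    ∃ m : L, ∀ (C : Type u) [BLAlgebra C] (f : Hom L C), (∀ a b : C, a ≤ b ∨ b ≤ a) →
      (0 : C) ≠ 1 → ∀ x ∈ l, Wit (f.toFun m) (f.toFun ∘ x.1) := by
  obtain ⟨m, hm⟩ := exists_wit (l.map Subtype.val) (by
    intro x hx
    obtain ⟨y, -, rfl⟩ := List.mem_map.1 hx
    exact y.2)
  exact ⟨m, fun C _ f hc h01 x hx => (hm C f hc h01).2 _ (List.mem_map_of_mem hx)⟩

theorem map_add_single {C : Type u} [BLAlgebra C] (f : Hom L C) (x : GoodSeq L) (m : L) :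
    f.toFun ∘ (x + single m).1 = seqAdd (f.toFun ∘ x.1) (onesThen 0 (f.toFun m)) := by
  rw [← map_sq]; exact map_seqAdd f _ _

theorem map_add {C : Type u} [BLAlgebra C] (f : Hom L C) (x y : GoodSeq L) :
    f.toFun ∘ (x + y).1 = seqAdd (f.toFun ∘ x.1) (f.toFun ∘ y.1) := map_seqAdd f _ _

/-- `x + k ≤ y + k` for some `k`. -/
def Below (x y : GoodSeq L) : Prop := ∃ k, x + k ≤ y + k

theorem exists_move {x y k : GoodSeq L} (h : x + k ≤ y + k) (l : List (GoodSeq L))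
    (hx : x ∈ l) (hy : y ∈ l) (hk : k ∈ l) {m : L}
    (hm : ∀ (C : Type u) [BLAlgebra C] (f : Hom L C), (∀ a b : C, a ≤ b ∨ b ≤ a) →
      (0 : C) ≠ 1 → ∀ x ∈ l, Wit (f.toFun m) (f.toFun ∘ x.1)) :
    x + single m ≤ y + single m := seq_le_of_chains fun C _ f hc h01 => by
  rw [map_add_single, map_add_single]
  refine chain_move hc h01 (x.2.map f) (y.2.map f) (k.2.map f) (hm C f hc h01 x hx)
    (hm C f hc h01 y hy) (hm C f hc h01 k hk) ?_
  rw [← map_add, ← map_add]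
  exact f.mono_seq h

theorem Below.refl (x : GoodSeq L) : Below x x := ⟨0, le_rfl⟩

theorem Below.trans {x y z : GoodSeq L} (h : Below x y) (h' : Below y z) : Below x z := by
  obtain ⟨k, h⟩ := h
  obtain ⟨k', h'⟩ := h'
  obtain ⟨m, hm⟩ := exists_wit' [x, y, z, k, k']
  exact ⟨single m, (exists_move h _ (by simp) (by simp) (by simp) hm).trans
    (exists_move h' _ (by simp) (by simp) (by simp) hm)⟩

theorem Below.antisymm {x y : GoodSeq L} (h : Below x y) (h' : Below y x) :
    ∃ k, x + k = y + k := by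
  obtain ⟨k, h⟩ := h
  obtain ⟨k', h'⟩ := h'
  obtain ⟨m, hm⟩ := exists_wit' [x, y, k, k']
  exact ⟨single m, le_antisymm (exists_move h _ (by simp) (by simp) (by simp) hm)
    (exists_move h' _ (by simp) (by simp) (by simp) hm)⟩

theorem Below.add_right {x y : GoodSeq L} (h : Below x y) (z : GoodSeq L) :
    Below (x + z) (y + z) := by
  obtain ⟨k, h⟩ := h
  obtain ⟨m, hm⟩ := exists_wit' [x, y, z, k]
  refine ⟨single m, seq_le_of_chains fun C _ f hc h01 => ?_⟩
  rw [map_add_single, map_add_single, map_add, map_add]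
  refine chain_add_right hc h01 (x.2.map f) (y.2.map f) (z.2.map f) (k.2.map f)
    (hm C f hc h01 x (by simp)) (hm C f hc h01 y (by simp)) (hm C f hc h01 z (by simp))
    (hm C f hc h01 k (by simp)) ?_
  rw [← map_add, ← map_add]
  exact f.mono_seq h

theorem Below.of_add_right {x y z : GoodSeq L} (h : Below (x + z) (y + z)) : Below x y := by
  obtain ⟨k, h⟩ := h
  obtain ⟨m, hm⟩ := exists_wit' [x, y, z, k, z + k]
  refine ⟨single m, seq_le_of_chains fun C _ f hc h01 => ?_⟩
  rw [map_add_single, map_add_single]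
  refine chain_cancel hc h01 (x.2.map f) (y.2.map f) (z.2.map f) (k.2.map f)
    (hm C f hc h01 x (by simp)) (hm C f hc h01 y (by simp)) (hm C f hc h01 z (by simp))
    (hm C f hc h01 k (by simp)) ?_ ?_
  · rw [← map_add]; exact hm C f hc h01 (z + k) (by simp)
  · rw [← map_add, ← map_add, ← map_add, ← map_add]
    exact f.mono_seq h

/-- Associativity, up to adding a common term. -/
theorem exists_assoc (x y z : GoodSeq L) : ∃ k, x + y + z + k = x + (y + z) + k := by
  obtain ⟨m, hm⟩ := exists_wit' [x, y, z]
  have key : ∀ (C : Type u) [BLAlgebra C] (f : Hom L C), (∀ a b : C, a ≤ b ∨ b ≤ a) →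
      (0 : C) ≠ 1 → f.toFun ∘ (x + y + z + single m).1 = f.toFun ∘ (x + (y + z) + single m).1 := by
    intro C _ f hc h01
    rw [map_add_single, map_add_single, map_add, map_add, map_add, map_add]
    exact chain_assoc hc h01 (x.2.map f) (y.2.map f) (z.2.map f)
      (hm C f hc h01 x (by simp)) (hm C f hc h01 y (by simp)) (hm C f hc h01 z (by simp))
  exact ⟨single m, le_antisymm
    (seq_le_of_chains fun C _ f hc h01 => (key C f hc h01).le)
    (seq_le_of_chains fun C _ f hc h01 => (key C f hc h01).ge)⟩

theorem below_assoc (x y z : GoodSeq L) : Below (x + y + z) (x + (y + z)) := by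
  obtain ⟨k, h⟩ := exists_assoc x y z
  exact ⟨k, h.le⟩

theorem below_assoc' (x y z : GoodSeq L) : Below (x + (y + z)) (x + y + z) := by
  obtain ⟨k, h⟩ := exists_assoc x y z
  exact ⟨k, h.ge⟩

theorem Below.add {x y z w : GoodSeq L} (h : Below x y) (h' : Below z w) :
    Below (x + z) (y + w) := by
  refine (h.add_right z).trans ?_
  rw [add_comm' y z, add_comm' y w]
  exact h'.add_right y

/-- Good sequences up to adding a common term. -/
instance quoSetoid (L : Type u) [BLAlgebra L] : Setoid (GoodSeq L) where
  r x y := Below x y ∧ Below y x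
  iseqv :=
    { refl := fun x => ⟨Below.refl x, Below.refl x⟩
      symm := fun h => ⟨h.2, h.1⟩
      trans := fun h h' => ⟨h.1.trans h'.1, h'.2.trans h.2⟩ }

/-- The cancellative quotient of the good sequences. -/
def Quo (L : Type u) [BLAlgebra L] : Type u := Quotient (quoSetoid L)

/-- The class of a good sequence. -/
def toQuo (x : GoodSeq L) : Quo L := Quotient.mk (quoSetoid L) x

instance instQuoAdd : Add (Quo L) :=
  ⟨Quotient.map₂ (fun x y => x + y) fun _ _ h _ _ h' => ⟨h.1.add h'.1, h.2.add h'.2⟩⟩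

instance instQuoZero : Zero (Quo L) := ⟨toQuo 0⟩

instance instQuoAddCommMonoid : AddCommMonoid (Quo L) where
  add_assoc := by
    rintro ⟨x⟩ ⟨y⟩ ⟨z⟩
    exact Quotient.sound ⟨below_assoc x y z, below_assoc' x y z⟩
  zero_add := by
    rintro ⟨x⟩
    exact congrArg toQuo ((add_comm' 0 x).trans (add_zero' x))
  add_zero := by
    rintro ⟨x⟩
    exact congrArg toQuo (add_zero' x)
  add_comm := by
    rintro ⟨x⟩ ⟨y⟩
    exact congrArg toQuo (add_comm' x y)
  nsmul := nsmulRec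

instance instQuoPartialOrder : PartialOrder (Quo L) where
  le := Quotient.lift₂ Below fun _ _ _ _ h h' => propext
    ⟨fun H => h.2.trans (H.trans h'.1), fun H => h.1.trans (H.trans h'.2)⟩
  le_refl := by
    rintro ⟨x⟩
    exact Below.refl x
  le_trans := by
    rintro ⟨x⟩ ⟨y⟩ ⟨z⟩ h h'
    exact Below.trans h h'
  le_antisymm := by
    rintro ⟨x⟩ ⟨y⟩ h h'
    exact Quotient.sound ⟨h, h'⟩

instance instQuoOrdered : IsOrderedCancelAddMonoid (Quo L) where
  add_le_add_left := by
    rintro ⟨x⟩ ⟨y⟩ h ⟨z⟩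
    exact Below.add_right h z
  le_of_add_le_add_left := by
    rintro ⟨x⟩ ⟨y⟩ ⟨z⟩ h
    refine Below.of_add_right (z := x) ?_
    rw [add_comm' y x, add_comm' z x]
    exact h

/-- Good sequences in an ordered group. -/
def val (x : GoodSeq L) : Algebra.GrothendieckAddGroup (Quo L) :=
  Algebra.GrothendieckAddGroup.of (toQuo x)

theorem val_add (x y : GoodSeq L) : val (x + y) = val x + val y :=
  _root_.map_add Algebra.GrothendieckAddGroup.of (toQuo x) (toQuo y)

theorem val_zero : val (0 : GoodSeq L) = 0 :=
  _root_.map_zero Algebra.GrothendieckAddGroup.of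

theorem val_le {x y : GoodSeq L} : val x ≤ val y ↔ ∃ k, x + k ≤ y + k := by
  change AddLocalization.mk (toQuo x) 0 ≤ AddLocalization.mk (toQuo y) 0 ↔ _
  rw [AddLocalization.mk_le_mk, AddSubmonoid.coe_zero, zero_add, zero_add]
  rfl

theorem val_eq {x y : GoodSeq L} : val x = val y ↔ ∃ k, x + k = y + k := by
  constructor
  · intro h
    exact Below.antisymm (val_le.1 h.le) (val_le.1 h.ge)
  · rintro ⟨k, h⟩
    exact le_antisymm (val_le.2 ⟨k, h.le⟩) (val_le.2 ⟨k, h.ge⟩)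

/-- The double complement of a good sequence. -/
def cc (a : GoodSeq L) : GoodSeq L := ⟨fun i => (a.1 i)ᶜᶜ, ccSeq_good a.2⟩

theorem cc_add (a b : GoodSeq L) : (a + b).cc = a.cc + b.cc := Subtype.ext (ccSeq_add a.1 b.1)

theorem cc_cc (a : GoodSeq L) : a.cc.cc = a.cc := Subtype.ext (ccSeq_ccSeq a.1)

end GoodSeq

section ChangGroup

/-- The relation `(a, b) ∼ (c, d)`: there is a good sequence `k` with `a + d + k = b + c + k`.
The sums are read as `(a + d) + k` and `(b + c) + k`; the addition of good sequences need not be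
associative, so the relation and the group are built directly on pairs of good sequences. -/
instance changSetoid (L : Type u) [BLAlgebra L] : Setoid (GoodSeq L × GoodSeq L) where
  r p q := ∃ k, p.1 + q.2 + k = p.2 + q.1 + k
  iseqv :=
    { refl := fun p => ⟨0, by rw [GoodSeq.add_comm' p.1]⟩
      symm := fun {p q} ⟨k, h⟩ => ⟨k, by
        rw [GoodSeq.add_comm' q.1, GoodSeq.add_comm' q.2]; exact h.symm⟩
      trans := fun {p q r} h h' => by
        have h1 := GoodSeq.val_eq.2 h
        have h2 := GoodSeq.val_eq.2 h'
        refine GoodSeq.val_eq.1 ?_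
        rw [GoodSeq.val_add, GoodSeq.val_add] at *
        rw [add_comm p.2.val, ← sub_eq_sub_iff_add_eq_add] at h1 ⊢
        rw [add_comm q.2.val, ← sub_eq_sub_iff_add_eq_add] at h2
        exact h1.trans h2 }

/-- The Chang group `G_L` of a BL-algebra `L`. -/
def ChangGroup (L : Type u) [BLAlgebra L] : Type u := Quotient (changSetoid L)

namespace ChangGroup

variable {L : Type u} [BLAlgebra L]

/-- The class `[a, b]`. -/
def mk (a b : GoodSeq L) : ChangGroup L := Quotient.mk (changSetoid L) (a, b)

theorem mk_eq_mk {a b c d : GoodSeq L} :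
    mk a b = mk c d ↔ ∃ k, a + d + k = b + c + k := by
  constructor
  · intro h; exact Quotient.exact h
  · intro h; exact Quotient.sound h

theorem mk_eq_mk_iff_val {a b c d : GoodSeq L} :
    mk a b = mk c d ↔ a.val - b.val = c.val - d.val := by
  rw [mk_eq_mk, ← GoodSeq.val_eq, GoodSeq.val_add, GoodSeq.val_add, sub_eq_sub_iff_add_eq_add,
    add_comm c.val]

/-- `[a, b] + [c, d] = [a + c, b + d]`. -/
instance instAdd : Add (ChangGroup L) :=
  ⟨Quotient.map₂ (fun p q => (p.1 + q.1, p.2 + q.2)) (by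
    rintro ⟨a, b⟩ ⟨a', b'⟩ h ⟨c, d⟩ ⟨c', d'⟩ h'
    have h1 := mk_eq_mk_iff_val.1 (mk_eq_mk.2 h)
    have h2 := mk_eq_mk_iff_val.1 (mk_eq_mk.2 h')
    refine mk_eq_mk.1 (mk_eq_mk_iff_val.2 ?_)
    rw [GoodSeq.val_add, GoodSeq.val_add, GoodSeq.val_add, GoodSeq.val_add, add_sub_add_comm, h1,
      h2, ← add_sub_add_comm])⟩

/-- The zero element `[(0), (0)]`. -/
instance instZero : Zero (ChangGroup L) := ⟨mk 0 0⟩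

/-- `-[a, b] = [b, a]`. -/
instance instNeg : Neg (ChangGroup L) :=
  ⟨Quotient.map (fun p => (p.2, p.1)) (by
    rintro ⟨a, b⟩ ⟨a', b'⟩ h
    have h1 := mk_eq_mk_iff_val.1 (mk_eq_mk.2 h)
    refine mk_eq_mk.1 (mk_eq_mk_iff_val.2 ?_)
    rw [← neg_sub, h1, neg_sub])⟩

theorem mk_add_mk (a b c d : GoodSeq L) : mk a b + mk c d = mk (a + c) (b + d) := rfl

theorem neg_mk (a b : GoodSeq L) : -mk a b = mk b a := rfl

theorem zero_def : (0 : ChangGroup L) = mk 0 0 := rfl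

instance instAddCommGroup : AddCommGroup (ChangGroup L) where
  add_assoc := by
    rintro ⟨a, b⟩ ⟨c, d⟩ ⟨e, f⟩
    refine mk_eq_mk_iff_val.2 ?_
    simp only [GoodSeq.val_add]
    rw [add_assoc, add_assoc]
  zero_add := by
    rintro ⟨a, b⟩
    refine mk_eq_mk_iff_val.2 ?_
    simp only [GoodSeq.val_add, GoodSeq.val_zero, zero_add]
  add_zero := by
    rintro ⟨a, b⟩
    refine mk_eq_mk_iff_val.2 ?_
    simp only [GoodSeq.val_add, GoodSeq.val_zero, add_zero]
  add_comm := by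
    rintro ⟨a, b⟩ ⟨c, d⟩
    refine mk_eq_mk_iff_val.2 ?_
    simp only [GoodSeq.val_add]
    rw [add_comm a.val, add_comm b.val]
  neg_add_cancel := by
    rintro ⟨a, b⟩
    refine mk_eq_mk_iff_val.2 ?_
    simp only [GoodSeq.val_add, GoodSeq.val_zero]
    rw [add_comm b.val, sub_self, sub_self]
  nsmul := nsmulRec
  zsmul := zsmulRec

theorem le_iff_val {a b c d : GoodSeq L} :
    (∃ k, a + d + k ≤ b + c + k) ↔ a.val - b.val ≤ c.val - d.val := by
  rw [← GoodSeq.val_le, GoodSeq.val_add, GoodSeq.val_add, sub_le_sub_iff, add_comm c.val]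

/-- The order `[a, b] ≼ [c, d]`: there is a good sequence `k` with `a + d + k ≤ b + c + k`. -/
instance instLE : LE (ChangGroup L) :=
  ⟨Quotient.lift₂ (fun p q => ∃ k, p.1 + q.2 + k ≤ p.2 + q.1 + k) (by
    rintro ⟨a, b⟩ ⟨c, d⟩ ⟨a', b'⟩ ⟨c', d'⟩ h h'
    have h1 := mk_eq_mk_iff_val.1 (mk_eq_mk.2 h)
    have h2 := mk_eq_mk_iff_val.1 (mk_eq_mk.2 h')
    rw [le_iff_val, le_iff_val, h1, h2])⟩

theorem mk_le_mk {a b c d : GoodSeq L} :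
    mk a b ≤ mk c d ↔ ∃ k, a + d + k ≤ b + c + k := Iff.rfl

instance instPartialOrder : PartialOrder (ChangGroup L) where
  le_refl := by
    rintro ⟨a, b⟩
    exact le_iff_val.2 le_rfl
  le_trans := by
    rintro ⟨a, b⟩ ⟨c, d⟩ ⟨e, f⟩ h h'
    exact le_iff_val.2 ((le_iff_val.1 h).trans (le_iff_val.1 h'))
  le_antisymm := by
    rintro ⟨a, b⟩ ⟨c, d⟩ h h'
    exact mk_eq_mk_iff_val.2 (le_antisymm (le_iff_val.1 h) (le_iff_val.1 h'))

/-- The order of `G_L` is translation invariant. -/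
instance instIsOrderedAddMonoid : IsOrderedAddMonoid (ChangGroup L) where
  add_le_add_left := by
    rintro ⟨a, b⟩ ⟨c, d⟩ h ⟨e, f⟩
    refine le_iff_val.2 ?_
    simp only [GoodSeq.val_add]
    rw [add_sub_add_comm, add_sub_add_comm c.val]
    exact add_le_add_left (le_iff_val.1 h) _

/-- The subgroup `𝔖(L)` of all `[a, b]` such that `a` and `b` have the same double complement. It
carries the order of `G_L`. -/
def S (L : Type u) [BLAlgebra L] : AddSubgroup (ChangGroup L) where
  carrier := {g | ∃ a b : GoodSeq L, g = mk a b ∧ a.cc = b.cc}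
  add_mem' := by
    rintro _ _ ⟨a, b, rfl, h⟩ ⟨c, d, rfl, h'⟩
    exact ⟨a + c, b + d, rfl, by rw [GoodSeq.cc_add, GoodSeq.cc_add, h, h']⟩
  zero_mem' := ⟨0, 0, rfl, rfl⟩
  neg_mem' := by
    rintro _ ⟨a, b, rfl, h⟩
    exact ⟨b, a, rfl, h.symm⟩

theorem mk_add_cc_mem (a b : GoodSeq L) : mk (a + b.cc) (b + a.cc) ∈ S L :=
  ⟨_, _, rfl, by
    rw [GoodSeq.cc_add, GoodSeq.cc_add, GoodSeq.cc_cc, GoodSeq.cc_cc, GoodSeq.add_comm']⟩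

end ChangGroup

end ChangGroup

/-! ### The MV-center -/

section MVCenter

/-- The MV-center `MV(L) = {x̄ : x ∈ L}`. -/
def MVCenter (L : Type u) [BLAlgebra L] : Type u := {x : L // ∃ y : L, x = yᶜ}

variable {L : Type u} [BLAlgebra L]

theorem MVCenter.cc_val (x : MVCenter L) : x.1ᶜᶜ = x.1 := by
  obtain ⟨y, hy⟩ := x.2
  rw [hy, ccc]

/-- The MV-center is a subalgebra. -/
instance MVCenter.instBLAlgebra : BLAlgebra (MVCenter L) where
  mul x y := ⟨x.1 * y.1, (x.1 * y.1)ᶜ, by rw [cc_mul, x.cc_val, y.cc_val]⟩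
  one := ⟨1, 0, compl_zero'.symm⟩
  zero := ⟨0, 1, compl_one'.symm⟩
  himp x y := ⟨x.1 ⇨ y.1, (x.1 ⇨ y.1)ᶜ, by rw [cc_himp, x.cc_val, y.cc_val]⟩
  mul_assoc x y z := Subtype.ext (mul_assoc x.1 y.1 z.1)
  one_mul x := Subtype.ext (one_mul x.1)
  mul_one x := Subtype.ext (mul_one x.1)
  mul_comm x y := Subtype.ext (mul_comm x.1 y.1)
  himp_self x := Subtype.ext (BLAlgebra.himp_self x.1)
  mul_himp_comm x y := Subtype.ext (BLAlgebra.mul_himp_comm x.1 y.1)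
  himp_himp x y z := Subtype.ext (BLAlgebra.himp_himp x.1 y.1 z.1)
  zero_himp x := Subtype.ext (BLAlgebra.zero_himp x.1)
  prelinear x y z := Subtype.ext (BLAlgebra.prelinear x.1 y.1 z.1)

/-- The double complement of a good sequence of `L`, as a good sequence of the MV-center. -/
def GoodSeq.toCenter (a : GoodSeq L) : GoodSeq (MVCenter L) :=
  ⟨fun i => ⟨(a.1 i)ᶜᶜ, (a.1 i)ᶜ, rfl⟩, fun i => Subtype.ext (a.cc.2.add_succ i), by
    obtain ⟨n, hn⟩ := a.cc.2.eventually_zero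
    exact ⟨n, fun r hr => Subtype.ext (hn r hr)⟩⟩

end MVCenter

end BLAlgebra

/-! The theorem is a split extension of abelian groups together with a remark on order. Double
complementation is an endomorphism of the BL-algebra: it respects `⊗` and `→` (`cc_mul`, `cc_himp`),
hence also `+`, and its image is the MV-center $A$, on which it is the identity. Applied entrywise
it gives an additive map $M_L \to M_A$ that is a retraction of the inclusion $M_A \to M_L$
(`GoodSeq.toCenter_add`, `GoodSeq.ofCenter_add`, `GoodSeq.toCenter_ofCenter`).

Any additive map $F$ of good sequences induces a homomorphism of Chang groups (`ChangGroup.map`):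
the auxiliary sequence $k$ in the relation is carried to $F(k)$. This needs neither associativity
nor cancellation in $M_L$. So there are homomorphisms $\pi : G_L \to G_A$ and $\iota : G_A \to G_L$
with $\pi\iota = \mathrm{id}$, and $G_L$ is the direct sum of $\iota(G_A)$ and $\ker\pi$, each $g$
being $\iota\pi g + (g - \iota\pi g)$.

The kernel is exactly $\mathfrak S(L)$. An element of $\mathfrak S(L)$ goes to a class $[c, c] = 0$
(`toCenter_eq_zero`). Conversely, for $g = [a, b]$, the difference $g - \iota\pi g$ is $[a +
\bar{\bar b}, b + \bar{\bar a}]$, whose two terms have the same double complement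
(`sub_ofCenter_toCenter_mem`). Thus $\Theta(g) = (\pi g, g - \iota\pi g)$, which is the stated
formula, and its inverse is $(h, s) \mapsto \iota h + s$.

For the order, $\pi$ is monotone because double complementation is. If $g \preceq h$, then either
$\pi g \prec \pi h$, and the lexicographic order asks for nothing more, or $\pi g = \pi h$, and the
second coordinates arise from $g$ and $h$ by subtracting the same element. -/

namespace BLAlgebra

universe u v

/-! ### Good sequences of the MV-center as a retract of the good sequences of the algebra -/

namespace MVCenter

variable {L : Type u} [BLAlgebra L]

/-- The inclusion of the MV-center. -/
def incl (L : Type u) [BLAlgebra L] : Hom (MVCenter L) L where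
  toFun := Subtype.val
  map_mul' _ _ := rfl
  map_himp' _ _ := rfl
  map_zero' := rfl

end MVCenter

namespace GoodSeq

variable {L : Type u} [BLAlgebra L]

/-- A good sequence of the MV-center, as a good sequence of the algebra. -/
def ofCenter (a : GoodSeq (MVCenter L)) : GoodSeq L := ⟨Subtype.val ∘ a.1, a.2.map (MVCenter.incl L)⟩

theorem ofCenter_injective : Function.Injective (ofCenter (L := L)) := fun _ _ h =>
  Subtype.ext (funext fun i => Subtype.ext (congrFun (congrArg Subtype.val h) i))

/-- The entries of a sum of good sequences are built from `+` and `*` alone, so every homomorphism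
of BL-algebras, here the inclusion, commutes with the sum. -/
theorem ofCenter_add (a b : GoodSeq (MVCenter L)) :
    (a + b).ofCenter = a.ofCenter + b.ofCenter :=
  Subtype.ext (map_seqAdd (MVCenter.incl L) a.1 b.1)

theorem ofCenter_mono {a b : GoodSeq (MVCenter L)} (h : a ≤ b) : a.ofCenter ≤ b.ofCenter :=
  (MVCenter.incl L).mono_seq h

/-- Retraction followed by inclusion is the idempotent `cc`. Since this is definitional, a statement
about `cc` in `L` can serve directly as a statement about images in the center. -/
theorem ofCenter_toCenter (a : GoodSeq L) : a.toCenter.ofCenter = a.cc := rfl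

/-- Each entry is a complement, and three complements amount to one. -/
theorem cc_ofCenter (a : GoodSeq (MVCenter L)) : a.ofCenter.cc = a.ofCenter :=
  Subtype.ext (funext fun i => (a.1 i).cc_val)

/-- The inclusion is a section of the retraction: after including both sides into `L`, this is the
fixed-point property `cc_ofCenter`. -/
theorem toCenter_ofCenter (a : GoodSeq (MVCenter L)) : a.ofCenter.toCenter = a :=
  ofCenter_injective (cc_ofCenter a)

/-- Carries the condition that defines `S L`, an equation between sequences of `L`, over to the
center, where the first coordinate of the isomorphism lives. -/
theorem toCenter_eq_toCenter {a b : GoodSeq L} (h : a.cc = b.cc) : a.toCenter = b.toCenter :=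
  ofCenter_injective h

/-- The inclusion is injective and additive, so additivity can be tested in `L`, where it is the
additivity of `cc`. -/
theorem toCenter_add (a b : GoodSeq L) : (a + b).toCenter = a.toCenter + b.toCenter :=
  ofCenter_injective (by
    rw [ofCenter_add, ofCenter_toCenter, ofCenter_toCenter, ofCenter_toCenter, cc_add])

/-- Complementation reverses the order, so doing it twice preserves it. The center uses the
implication of `L`, hence its order is the restricted one. -/
theorem toCenter_mono {a b : GoodSeq L} (h : a ≤ b) : a.toCenter ≤ b.toCenter := fun i =>
  Subtype.ext (le_iff_himp.1 (compl_anti (compl_anti (h i))))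

end GoodSeq

/-! ### Induced homomorphisms of Chang groups and the splitting -/

namespace ChangGroup

variable {L : Type u} [BLAlgebra L] {M : Type v} [BLAlgebra M]

theorem mk_self (a : GoodSeq L) : mk a a = 0 :=
  mk_eq_mk.2 ⟨0, rfl⟩

/-- The homomorphism of Chang groups induced by an additive map of good sequences. -/
def map (F : GoodSeq L → GoodSeq M) (hF : ∀ a b, F (a + b) = F a + F b) :
    ChangGroup L →+ ChangGroup M where
  toFun := Quotient.lift (fun p => mk (F p.1) (F p.2)) (by
    rintro ⟨a, b⟩ ⟨c, d⟩ ⟨k, h⟩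
    -- The image of the old auxiliary sequence is the new one. Additivity, applied twice on each
    -- side, folds the two bracketed sums into the images under `F` of the two sides of `h`, with no
    -- rebracketing.
    refine mk_eq_mk.2 ⟨F k, ?_⟩
    rw [← hF, ← hF, ← hF, ← hF]
    exact congrArg F h)
  -- It is not required that `F 0` be the zero sequence: the class of a pair with equal entries
  -- vanishes in any case.
  map_zero' := mk_self (F 0)
  map_add' := by
    rintro ⟨a, b⟩ ⟨c, d⟩
    change mk (F (a + c)) (F (b + d)) = mk (F a) (F b) + mk (F c) (F d)
    rw [hF, hF, mk_add_mk]

/-- The order of the Chang group has the same shape as its equality, with `≤` for `=`, so the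
witness `F k` works again. -/
theorem map_mono (F : GoodSeq L → GoodSeq M) (hF : ∀ a b, F (a + b) = F a + F b)
    (hF' : ∀ {a b}, a ≤ b → F a ≤ F b) : Monotone (map F hF) := by
  rintro ⟨a, b⟩ ⟨c, d⟩ ⟨k, h⟩
  refine mk_le_mk.2 ⟨F k, ?_⟩
  rw [← hF, ← hF, ← hF, ← hF]
  exact hF' h

/-- The homomorphism `[a, b] ↦ [a̿, b̿]` onto the Chang group of the MV-center. -/
def toCenter (L : Type u) [BLAlgebra L] : ChangGroup L →+ ChangGroup (MVCenter L) :=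
  map GoodSeq.toCenter GoodSeq.toCenter_add

/-- The homomorphism induced by the inclusion of the MV-center. -/
def ofCenter (L : Type u) [BLAlgebra L] : ChangGroup (MVCenter L) →+ ChangGroup L :=
  map GoodSeq.ofCenter GoodSeq.ofCenter_add

theorem toCenter_mono : Monotone (toCenter L) := map_mono _ _ GoodSeq.toCenter_mono

/-- The splitting of the groups, inherited from the retraction on representatives. -/
theorem toCenter_ofCenter (g : ChangGroup (MVCenter L)) : toCenter L (ofCenter L g) = g := by
  obtain ⟨a, b⟩ := g
  change mk _ _ = mk a b
  rw [GoodSeq.toCenter_ofCenter, GoodSeq.toCenter_ofCenter]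

/-- One half of the identification of `S L` with the kernel of `toCenter`: both entries of the
representing pair have the same image in the center. -/
theorem toCenter_eq_zero {s : ChangGroup L} (hs : s ∈ S L) : toCenter L s = 0 := by
  obtain ⟨a, b, rfl, h⟩ := hs
  change mk _ _ = _
  rw [GoodSeq.toCenter_eq_toCenter h, mk_self]

/-- Negation swaps the entries of a pair and addition is entrywise. The swap is what puts the double
complement of `b` next to `a`; on representatives both sides are the same pair. -/
theorem mk_sub_ofCenter_toCenter (a b : GoodSeq L) :
    mk a b - ofCenter L (toCenter L (mk a b)) = mk (a + b.cc) (b + a.cc) := by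
  rw [sub_eq_add_neg]
  rfl

/-- The other half: an element killed by `toCenter` equals this difference, hence lies in `S L`. It
also makes the second coordinate of the isomorphism well defined. -/
theorem sub_ofCenter_toCenter_mem (g : ChangGroup L) : g - ofCenter L (toCenter L g) ∈ S L := by
  obtain ⟨a, b⟩ := g
  exact (mk_sub_ofCenter_toCenter a b).symm ▸ mk_add_cc_mem a b

/-! ### The isomorphism with the lexicographic product -/

/-- The Chang group is the product of the Chang group of the MV-center and `𝔖(L)`. -/
def lexEquiv (L : Type u) [BLAlgebra L] :
    ChangGroup L ≃+ (ChangGroup (MVCenter L) ×ₗ S L) where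
  toFun g := toLex (toCenter L g, ⟨g - ofCenter L (toCenter L g), sub_ofCenter_toCenter_mem g⟩)
  invFun p := ofCenter L (ofLex p).1 + (ofLex p).2
  left_inv g := add_sub_cancel _ g
  right_inv p := by
    -- The first summand is returned by the splitting and the second is in the kernel. Once the
    -- first coordinate is recovered, subtracting its image leaves the second.
    have h : toCenter L (ofCenter L (ofLex p).1 + (ofLex p).2) = (ofLex p).1 := by
      rw [_root_.map_add, toCenter_ofCenter, toCenter_eq_zero (ofLex p).2.2, add_zero]
    refine ofLex.injective (Prod.ext h (Subtype.ext ?_))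
    change _ - ofCenter L (toCenter L _) = _
    rw [h, add_sub_cancel_left]
  map_add' g h := by
    refine ofLex.injective (Prod.ext (_root_.map_add _ g h) (Subtype.ext ?_))
    change g + h - ofCenter L (toCenter L (g + h)) = _
    rw [_root_.map_add, _root_.map_add, add_sub_add_comm]
    rfl

theorem lexEquiv_mk (a b : GoodSeq L) :
    lexEquiv L (mk a b) =
      toLex (mk a.toCenter b.toCenter, ⟨mk (a + b.cc) (b + a.cc), mk_add_cc_mem a b⟩) :=
  ofLex.injective (Prod.ext rfl (Subtype.ext (mk_sub_ofCenter_toCenter a b)))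

/-- Monotonicity of `toCenter` and translation invariance of the order suffice; neither group has to
be totally ordered. -/
theorem lexEquiv_mono : Monotone (lexEquiv L) := by
  intro g h hgh
  -- Strict inequality of the first coordinates already decides the lexicographic order, so the
  -- second coordinates are compared only when the first agree.
  refine Prod.Lex.le_iff.2 ((toCenter_mono hgh).lt_or_eq.imp_right fun e => ⟨e, ?_⟩)
  change g - ofCenter L (toCenter L g) ≤ h - ofCenter L (toCenter L h)
  -- Now the same element is subtracted on both sides.
  rw [show toCenter L g = toCenter L h from e]
  exact sub_le_sub_right hgh _

end ChangGroup

end BLAlgebra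

theorem corollary5p5 {L : Type*} [BLAlgebra L] :
    ∃ Θ : BLAlgebra.ChangGroup L ≃+
        (BLAlgebra.ChangGroup (BLAlgebra.MVCenter L) ×ₗ BLAlgebra.ChangGroup.S L),
      Monotone Θ ∧
      ∀ a b : BLAlgebra.GoodSeq L,
        Θ (BLAlgebra.ChangGroup.mk a b) =
          toLex (BLAlgebra.ChangGroup.mk a.toCenter b.toCenter,
            ⟨BLAlgebra.ChangGroup.mk (a + b.cc) (b + a.cc),
              BLAlgebra.ChangGroup.mk_add_cc_mem a b⟩) :=
  ⟨BLAlgebra.ChangGroup.lexEquiv L, BLAlgebra.ChangGroup.lexEquiv_mono,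
    BLAlgebra.ChangGroup.lexEquiv_mk⟩
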